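/- For integers $1\le k\le d$ and a finite set $V\subset\mathbb{R}^d$, let $$\mathrm{maxdet}_k(V)=\max_{S\subseteq V,\ |S|=k}\det\big(\langle u,v\rangle\big)_{u,v\in S}$$ be the optimal value of the $k$-determinant maximization problem on $V$ (with value $0$ if $|V|<k$). A map $c$ that sends every finite set $V\subset\mathbb{R}^d$ to a subset $c(V)\subseteq V$ is called an $\alpha$-composable core-set of size at most $t$ for this problem if $|c(V)|\le t$ for every finite $V\subset\mathbb{R}^d$, and $$\mathrm{maxdet}_k\big(c(V_1)\cup\dots\cup c(V_m)\big)\ \ge\ \frac1\alpha\,\mathrm{maxdet}_k\big(V_1\cup\dots\cup V_m\big)$$ for every finite collection of finite sets $V_1,\dots,V_m\subset\mathbb{R}^d$. **Theorem.** There is a polynomial time algorithm for computing an $O(k^2\log^3 k)^k$-composable core-set of size $O(k\log^2 k)$ for the $k$-determinant maximization problem. Precisely, there are a universal constant $C>0$, a single algorithm $\mathcal A$ (a program of a real random access machine, with unit-cost exact arithmetic and comparisons on real numbers), a polynomial $P$, and, for all integers $1\le k\le d$, a map $c_{d,k}$ from the finite subsets of $\mathbb{R}^d$ to the finite subsets of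 $\mathbb{R}^d$, such that for all $1\le k\le d$: 1. $c_{d,k}$ is a $\big(C k^2\log^3(k+1)\big)^k$-composable core-set for the $k$-determinant maximization problem on $\mathbb{R}^d$; 2. $|c_{d,k}(V)|\le C\,k\log^2(k+1)$ for every finite $V\subset\mathbb{R}^d$; 3. given $d$, $k$ and the elements of any finite set $V\subset\mathbb{R}^d$, listed without repetition in any order, $\mathcal A$ outputs $c_{d,k}(V)$ in at most $P(|V|+d)$ steps. -/

import Mathlib

/-! ### The `k`-determinant maximization problem -/

/-- The points of `ℝ^d`, with the Euclidean inner product. -/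
abbrev Pt (d : ℕ) : Type := EuclideanSpace ℝ (Fin d)

/-- The determinant of the Gram matrix `(⟨u, v⟩)_{u, v ∈ S}` of a finite set of vectors, that is,
the squared `|S|`-dimensional volume of the parallelepiped spanned by `S`. -/
noncomputable def gramDet {d : ℕ} (S : Finset (Pt d)) : ℝ :=
  (Matrix.gram ℝ fun u : {x // x ∈ S} => u.1).det

/-- The optimal value of `k`-determinant maximization on `V`: the largest `gramDet S` over the
subsets `S ⊆ V` with exactly `k` elements. These are finitely many nonnegative numbers; the value
is `0` if `V` has fewer than `k` elements. -/
noncomputable def detMax {d : ℕ} (k : ℕ) (V : Finset (Pt d)) : ℝ :=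
  sSup {x : ℝ | ∃ S : Finset (Pt d), S ⊆ V ∧ S.card = k ∧ x = gramDet S}

/-! ### Composable core-sets -/

open Classical in
/-- `c` maps every finite set to one of its subsets, and for every finite collection of finite sets
`V_1, …, V_m` we have `f (c V_1 ∪ … ∪ c V_m) ≥ (1 / α) f (V_1 ∪ … ∪ V_m)`. -/
def IsComposableCoreset {E : Type} (f : Finset E → ℝ) (α : ℝ) (c : Finset E → Finset E) : Prop :=
  (∀ V : Finset E, c V ⊆ V) ∧
    ∀ (m : ℕ) (V : Fin m → Finset E),
      f (Finset.univ.biUnion fun i => c (V i)) ≥ (1 / α) * f (Finset.univ.biUnion V)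

/-! ### Real random access machines

Programs are finite pieces of syntax. The memory consists of registers and arrays that hold natural
numbers or real numbers. On real numbers there are the exact arithmetic operations, comparisons, and
rational constants; on natural numbers there are addition, truncated subtraction and comparisons,
and only natural numbers can be used as array indices. Every operation, memory access and test costs
one step. -/

namespace RealRAM

/-- Natural number registers, real registers, one-dimensional arrays of natural numbers and
two-dimensional arrays of real numbers (first argument: the name of the register or array). -/
structure State where
  ireg : ℕ → ℕ
  rreg : ℕ → ℝ
  iarr : ℕ → ℕ → ℕ
  rarr : ℕ → ℕ → ℕ → ℝ

/-- Expressions for natural numbers; `get a i` reads the entry `i` of the array `a`. -/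
inductive IExp where
  | const (m : ℕ)
  | reg (x : ℕ)
  | get (a : ℕ) (i : IExp)
  | add (e f : IExp)
  | sub (e f : IExp)

/-- Expressions for real numbers; `get a i j` reads the entry `(i, j)` of the array `a`. -/
inductive RExp where
  | const (q : ℚ)
  | reg (x : ℕ)
  | get (a : ℕ) (i j : IExp)
  | add (e f : RExp)
  | sub (e f : RExp)
  | mul (e f : RExp)
  | div (e f : RExp)

/-- Tests. -/
inductive BExp where
  | ilt (e f : IExp)
  | rlt (e f : RExp)
  | not (b : BExp)
  | and (b c : BExp)

/-- Programs. -/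
inductive Prog where
  | skip
  | iset (x : ℕ) (e : IExp)
  | rset (x : ℕ) (e : RExp)
  | iput (a : ℕ) (i : IExp) (e : IExp)
  | rput (a : ℕ) (i j : IExp) (e : RExp)
  | seq (p q : Prog)
  | cond (b : BExp) (p q : Prog)
  | loop (b : BExp) (p : Prog)

/-- Value of an expression. -/
def IExp.eval (s : State) : IExp → ℕ
  | .const m => m
  | .reg x => s.ireg x
  | .get a i => s.iarr a (i.eval s)
  | .add e f => e.eval s + f.eval s
  | .sub e f => e.eval s - f.eval s

/-- Number of steps needed to evaluate an expression. -/
def IExp.size : IExp → ℕ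
  | .const _ => 1
  | .reg _ => 1
  | .get _ i => i.size + 1
  | .add e f => e.size + f.size + 1
  | .sub e f => e.size + f.size + 1

/-- Value of an expression (division by zero returns zero). -/
noncomputable def RExp.eval (s : State) : RExp → ℝ
  | .const q => (q : ℝ)
  | .reg x => s.rreg x
  | .get a i j => s.rarr a (i.eval s) (j.eval s)
  | .add e f => e.eval s + f.eval s
  | .sub e f => e.eval s - f.eval s
  | .mul e f => e.eval s * f.eval s
  | .div e f => e.eval s / f.eval s

/-- Number of steps needed to evaluate an expression. -/
def RExp.size : RExp → ℕ
  | .const _ => 1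
  | .reg _ => 1
  | .get _ i j => i.size + j.size + 1
  | .add e f => e.size + f.size + 1
  | .sub e f => e.size + f.size + 1
  | .mul e f => e.size + f.size + 1
  | .div e f => e.size + f.size + 1

/-- Truth of a test. -/
def BExp.holds (s : State) : BExp → Prop
  | .ilt e f => e.eval s < f.eval s
  | .rlt e f => e.eval s < f.eval s
  | .not b => ¬ b.holds s
  | .and b c => b.holds s ∧ c.holds s

/-- Number of steps needed to evaluate a test. -/
def BExp.size : BExp → ℕ
  | .ilt e f => e.size + f.size + 1
  | .rlt e f => e.size + f.size + 1
  | .not b => b.size + 1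
  | .and b c => b.size + c.size + 1

/-- Overwrite a natural number register. -/
def State.setI (s : State) (x m : ℕ) : State :=
  { s with ireg := Function.update s.ireg x m }

/-- Overwrite a real register. -/
noncomputable def State.setR (s : State) (x : ℕ) (r : ℝ) : State :=
  { s with rreg := Function.update s.rreg x r }

/-- Overwrite the entry `i` of the natural number array `a`. -/
def State.putI (s : State) (a i m : ℕ) : State :=
  { s with iarr := Function.update s.iarr a (Function.update (s.iarr a) i m) }

/-- Overwrite the entry `(i, j)` of the real array `a`. -/
noncomputable def State.putR (s : State) (a i j : ℕ) (r : ℝ) : State :=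
  { s with
    rarr :=
      Function.update s.rarr a (Function.update (s.rarr a) i (Function.update (s.rarr a i) j r)) }

/-- `Exec p s s' t`: the program `p`, started in the state `s`, halts in the state `s'` after
exactly `t` steps. -/
inductive Exec : Prog → State → State → ℕ → Prop where
  | skip (s : State) : Exec .skip s s 1
  | iset (s : State) (x : ℕ) (e : IExp) :
      Exec (.iset x e) s (s.setI x (e.eval s)) (e.size + 1)
  | rset (s : State) (x : ℕ) (e : RExp) :
      Exec (.rset x e) s (s.setR x (e.eval s)) (e.size + 1)
  | iput (s : State) (a : ℕ) (i e : IExp) :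
      Exec (.iput a i e) s (s.putI a (i.eval s) (e.eval s)) (i.size + e.size + 1)
  | rput (s : State) (a : ℕ) (i j : IExp) (e : RExp) :
      Exec (.rput a i j e) s (s.putR a (i.eval s) (j.eval s) (e.eval s))
        (i.size + j.size + e.size + 1)
  | seq {p q : Prog} {s s' s'' : State} {t t' : ℕ} :
      Exec p s s' t → Exec q s' s'' t' → Exec (.seq p q) s s'' (t + t')
  | cond_true {b : BExp} {p q : Prog} {s s' : State} {t : ℕ} :
      b.holds s → Exec p s s' t → Exec (.cond b p q) s s' (b.size + 1 + t)
  | cond_false {b : BExp} {p q : Prog} {s s' : State} {t : ℕ} :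
      ¬ b.holds s → Exec q s s' t → Exec (.cond b p q) s s' (b.size + 1 + t)
  | loop_true {b : BExp} {p : Prog} {s s' s'' : State} {t t' : ℕ} :
      b.holds s → Exec p s s' t → Exec (.loop b p) s' s'' t' →
        Exec (.loop b p) s s'' (b.size + 1 + t + t')
  | loop_false {b : BExp} {p : Prog} {s : State} :
      ¬ b.holds s → Exec (.loop b p) s s (b.size + 1)

/-- The initial state on the input `(v_0, …, v_{n-1}) ∈ (ℝ^d)^n` and the parameter `k`: the natural
number registers `0, 1, 2` hold `n, d, k`, the entry `(i, j)` of the real array `0` is the `j`-th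
coordinate of `v_i`, and everything else is `0`. -/
noncomputable def initState {n d : ℕ} (k : ℕ) (v : Fin n → Pt d) : State where
  ireg x := if x = 0 then n else if x = 1 then d else if x = 2 then k else 0
  rreg _ := 0
  iarr _ _ := 0
  rarr a i j := if h : a = 0 ∧ i < n ∧ j < d then v ⟨i, h.2.1⟩ ⟨j, h.2.2⟩ else 0

/-- The output of a halted machine is read as a set of input vectors: the natural number register
`0` holds the number of elements of `W`, and the entries of the natural number array `0` below that
number are the positions in the input of the elements of `W`. -/
def Outputs {n d : ℕ} (s : State) (v : Fin n → Pt d) (W : Finset (Pt d)) : Prop :=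
  s.ireg 0 = W.card ∧
    ∀ w : Pt d, w ∈ W ↔ ∃ j : ℕ, j < s.ireg 0 ∧ ∃ i : Fin n, s.iarr 0 j = (i : ℕ) ∧ v i = w

open Classical in
/-- The program `p`, with the parameter `k`, computes the map `c` on the finite subsets of `ℝ^d` in
at most `T n` steps on sets of `n` vectors: on every listing without repetition of the elements of
a set `V`, in whatever order, it halts within that time and outputs `c V`. -/
def ComputesInTime {d : ℕ} (p : Prog) (k : ℕ) (c : Finset (Pt d) → Finset (Pt d))
    (T : ℕ → ℕ) : Prop :=
  ∀ (n : ℕ) (v : Fin n → Pt d), Function.Injective v →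
    ∃ (s : State) (t : ℕ), Exec p (initState k v) s t ∧ t ≤ T n ∧
      Outputs s v (c (Finset.univ.image v))

end RealRAM

/-! The core-set of `V` is an approximate local optimum of the volume: at most `k` independent
vectors of `V` such that no exchange of one of them for a vector of `V` multiplies the Gram
determinant by more than 4, and which span `V` if they are fewer than `k` (`IsLocalOpt`).

Such a set keeps all directions. Local optimality says that `v` is at most twice as far from the
span of all but one chosen vector as the omitted one is. Hence the projection of `v` to the chosen
span has coefficients at most 2, and the residual is small compared with the part of each chosen
vector orthogonal to the others. It follows (`distTo_le_sum`, `distTo_le_of_gdet_update_le`) that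
for every subspace `G` of dimension below `k` some chosen vector is at least `1/(4k)` times as far
from `G` as `v` is.

This property passes to unions. Given an optimal `k`-tuple in the union of the `V_i`, exchange its
vectors one by one for core-set vectors, taking `G` to be the span of the other `k - 1` vectors. A
Gram determinant is a squared distance times the determinant of the rest, so each exchange costs a
factor `(4k)^2`, and `(4k)^(2k)` in total (`exists_gdet_le_of_distTo_le`,
`isComposableCoreset_of_isLocalOpt`). Both required bounds hold without their logarithms, which
exceed `1/2` and are absorbed by the constant.

For the running time, a greedy choice of `r` vectors is within `4^((r+1)r)` of the best `r`-tuple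
(`gdet_le_of_greedy`). Each scan over all exchanges that is not already at a local optimum gains a
factor above 4, so `3k^2` scans suffice (`run_selectProg`). To make the output independent of the
listing, the input is first sorted colexicographically, and the selection reads nothing that depends
on the original order (`run_prepProg`, `Agree.run`). -/

/-! ### Distances to subspaces and Gram determinants -/

section Geometry

variable {E : Type*} [NormedAddCommGroup E] [InnerProductSpace ℝ E]

/-- The Gram determinant of a family of vectors. -/
noncomputable def gdet {ι : Type*} [Fintype ι] [DecidableEq ι] (f : ι → E) : ℝ :=
  (Matrix.gram ℝ f).det

theorem gdet_nonneg {ι : Type*} [Fintype ι] [DecidableEq ι] (f : ι → E) : 0 ≤ gdet f :=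
  (Matrix.posSemidef_gram ℝ f).det_nonneg

theorem gdet_ne_zero_iff {ι : Type*} [Fintype ι] [DecidableEq ι] {f : ι → E} :
    gdet f ≠ 0 ↔ LinearIndependent ℝ f :=
  Matrix.det_gram_ne_zero_iff_linearIndependent

theorem gdet_comp_equiv {ι κ : Type*} [Fintype ι] [DecidableEq ι] [Fintype κ] [DecidableEq κ]
    (f : ι → E) (σ : κ ≃ ι) : gdet (f ∘ σ) = gdet f := by
  unfold gdet
  exact Matrix.det_submatrix_equiv_self σ (Matrix.gram ℝ f)

/-- On the Gram matrix this is a row operation followed by the same column operation, and neither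
changes the determinant. -/
theorem gdet_update_add_smul {ι : Type*} [Fintype ι] [DecidableEq ι] (f : ι → E) {i j : ι}
    (hij : i ≠ j) (v : E) (c : ℝ) :
    gdet (Function.update f i (v + c • f j)) = gdet (Function.update f i v) := by
  unfold gdet
  set A := Matrix.gram ℝ (Function.update f i v)
  have h : Matrix.gram ℝ (Function.update f i (v + c • f j)) =
      ((A.updateRow i (A i + c • A j)).updateCol i
        (fun a => (A.updateRow i (A i + c • A j)) a i +
          c • (A.updateRow i (A i + c • A j)) a j)) := by
    ext a b
    by_cases ha : a = i <;> by_cases hb : b = i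
    · subst ha
      subst hb
      simp only [A, Matrix.updateCol_self, Matrix.updateRow_self, Matrix.gram_apply,
        Function.update_self, Function.update_of_ne hij.symm, Pi.add_apply, Pi.smul_apply,
        inner_add_left, inner_add_right, real_inner_smul_left, real_inner_smul_right, smul_eq_mul]
      ring
    · subst ha
      simp only [A, Matrix.updateCol_ne hb, Matrix.updateRow_self, Matrix.gram_apply,
        Function.update_self, Function.update_of_ne hij.symm, Function.update_of_ne hb,
        Pi.add_apply, Pi.smul_apply, inner_add_left, real_inner_smul_left, smul_eq_mul]
    · subst hb
      simp only [A, Matrix.updateCol_self, Matrix.updateRow_ne ha, Matrix.gram_apply,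
        Function.update_self, Function.update_of_ne hij.symm, Function.update_of_ne ha,
        inner_add_right, real_inner_smul_right, smul_eq_mul]
    · simp only [A, Matrix.updateCol_ne hb, Matrix.updateRow_ne ha, Matrix.gram_apply,
        Function.update_of_ne hb, Function.update_of_ne ha]
  rw [h, Matrix.det_updateCol_add_smul_self _ hij, Matrix.det_updateRow_add_smul_self _ hij]

theorem gdet_update_add_of_mem_span {ι : Type*} [Fintype ι] [DecidableEq ι] (f : ι → E) (i : ι)
    {q : E} (hq : q ∈ Submodule.span ℝ (f '' {j | j ≠ i})) (v : E) :
    gdet (Function.update f i (v + q)) = gdet (Function.update f i v) := by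
  -- The induction over the span needs every base point and every coefficient: sums move the base
  -- point, multiples change the coefficient.
  suffices h : ∀ (c : ℝ) (v : E),
      gdet (Function.update f i (v + c • q)) = gdet (Function.update f i v) by
    simpa using h 1 v
  induction hq using Submodule.span_induction with
  | mem x hx =>
    obtain ⟨j, hj, rfl⟩ := hx
    exact fun c v => gdet_update_add_smul f (Ne.symm hj) v c
  | zero => simp
  | add x y _ _ hx hy =>
    intro c v
    rw [smul_add, ← add_assoc, hy, hx]
  | smul a x _ hx =>
    intro c v
    rw [smul_smul, hx]

/-- Row `i` of the Gram matrix vanishes off the diagonal, so the expansion along it has one term. -/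
theorem gdet_update_of_orthogonal {m : ℕ} (f : Fin (m + 1) → E) (i : Fin (m + 1)) {p : E}
    (hp : ∀ j, j ≠ i → inner ℝ p (f j) = 0) :
    gdet (Function.update f i p) = ‖p‖ ^ 2 * gdet (f ∘ i.succAbove) := by
  unfold gdet
  rw [Matrix.det_succ_row _ i, Finset.sum_eq_single i]
  · have : (Matrix.gram ℝ (Function.update f i p)).submatrix i.succAbove i.succAbove =
        Matrix.gram ℝ (f ∘ i.succAbove) := by
      ext a b
      simp
    rw [this]
    simp [← two_mul, pow_mul]
  · intro j _ hj
    simp [hj, hp j hj]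
  · simp

/-- Makes the span of the remaining vectors an admissible low-dimensional subspace when vectors are
exchanged one at a time. -/
theorem finrank_span_image_ne_lt {m : ℕ} (f : Fin (m + 1) → E) (i : Fin (m + 1)) :
    Module.finrank ℝ (Submodule.span ℝ (f '' {j | j ≠ i})) < m + 1 := by
  classical
  have h : f '' {j | j ≠ i} = ((Finset.univ.erase i).image f : Finset E) := by
    ext; simp
  rw [h]
  refine lt_of_le_of_lt (finrank_span_finset_le_card _) (lt_of_le_of_lt Finset.card_image_le ?_)
  simp

variable [FiniteDimensional ℝ E]

/-- The distance of `v` to the subspace `W`. -/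
noncomputable def distTo (W : Submodule ℝ E) (v : E) : ℝ := ‖v - W.starProjection v‖

theorem distTo_nonneg (W : Submodule ℝ E) (v : E) : 0 ≤ distTo W v := norm_nonneg _

theorem distTo_add_le (W : Submodule ℝ E) (v w : E) :
    distTo W (v + w) ≤ distTo W v + distTo W w := by
  unfold distTo
  rw [map_add, add_sub_add_comm]
  exact norm_add_le _ _

theorem distTo_smul (W : Submodule ℝ E) (a : ℝ) (v : E) : distTo W (a • v) = |a| * distTo W v := by
  unfold distTo
  rw [map_smul, ← smul_sub, norm_smul, Real.norm_eq_abs]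

theorem distTo_sum_le {ι : Type*} (W : Submodule ℝ E) (s : Finset ι) (f : ι → E) :
    distTo W (∑ i ∈ s, f i) ≤ ∑ i ∈ s, distTo W (f i) := by
  unfold distTo
  rw [map_sum, ← Finset.sum_sub_distrib]
  exact norm_sum_le _ _

theorem distTo_le_norm_sub (W : Submodule ℝ E) (v : E) {q : E} (hq : q ∈ W) :
    distTo W v ≤ ‖v - q‖ := by
  unfold distTo
  rw [Submodule.starProjection_minimal]
  exact ciInf_le ⟨0, by rintro _ ⟨x, rfl⟩; exact norm_nonneg _⟩ (⟨q, hq⟩ : W)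

theorem distTo_le_norm (W : Submodule ℝ E) (v : E) : distTo W v ≤ ‖v‖ := by
  simpa using distTo_le_norm_sub W v W.zero_mem

theorem distTo_mono {W W' : Submodule ℝ E} (h : W ≤ W') (v : E) : distTo W' v ≤ distTo W v :=
  distTo_le_norm_sub W' v (h (W.starProjection_apply_mem v))

theorem distTo_eq_norm_sub {W : Submodule ℝ E} {v q : E} (hq : q ∈ W) (h : v - q ∈ Wᗮ) :
    distTo W v = ‖v - q‖ := by
  unfold distTo
  rw [Submodule.eq_starProjection_of_mem_orthogonal hq h]

/-- Only the component of `v` orthogonal to `W` contributes to the inner product; then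
Cauchy–Schwarz. -/
theorem abs_inner_le_distTo {W : Submodule ℝ E} {u : E} (hu : u ∈ Wᗮ) (v : E) :
    |inner ℝ v u| ≤ distTo W v * ‖u‖ := by
  have h : inner ℝ v u = inner ℝ (v - W.starProjection v) u := by
    rw [inner_sub_left, (Submodule.mem_orthogonal W u).1 hu _ (W.starProjection_apply_mem v),
      sub_zero]
  rw [h]
  exact abs_real_inner_le_norm _ _

/-- Replacing one vector: the Gram determinant is the squared distance to the span of the others
times the Gram determinant of the others. -/
theorem gdet_update {m : ℕ} (f : Fin (m + 1) → E) (i : Fin (m + 1)) (v : E) :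
    gdet (Function.update f i v) =
      distTo (Submodule.span ℝ (f '' {j | j ≠ i})) v ^ 2 * gdet (f ∘ i.succAbove) := by
  set W := Submodule.span ℝ (f '' {j | j ≠ i})
  have h1 : v = (v - W.starProjection v) + W.starProjection v := by abel
  conv_lhs => rw [h1]
  rw [gdet_update_add_of_mem_span f i (W.starProjection_apply_mem v), distTo]
  refine gdet_update_of_orthogonal f i fun j hj => ?_
  exact W.starProjection_inner_eq_zero v _ (Submodule.subset_span ⟨j, hj, rfl⟩)

/-- If every vector of `A` is, up to a factor `β`, at most as far from each low-dimensional
subspace as some vector of `C`, then the largest Gram determinants in `A` and `C` are comparable. -/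
theorem exists_gdet_le_of_distTo_le {k : ℕ} {A C : Set E} {β : ℝ}
    (h : ∀ G : Submodule ℝ E, Module.finrank ℝ G < k → ∀ v ∈ A, 0 < distTo G v →
      ∃ c ∈ C, distTo G v ≤ β * distTo G c)
    (o : Fin k → E) (ho : ∀ i, o i ∈ A) (hpos : 0 < gdet o) :
    ∃ o' : Fin k → E, (∀ i, o' i ∈ C) ∧ gdet o ≤ (β ^ 2) ^ k * gdet o' := by
  -- Hybrid argument: the first `m` vectors have been exchanged for vectors of `C`, each at the
  -- price of a factor `β ^ 2`.
  suffices H : ∀ m ≤ k, ∃ o' : Fin k → E, (∀ i : Fin k, (i : ℕ) < m → o' i ∈ C) ∧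
      (∀ i : Fin k, m ≤ (i : ℕ) → o' i ∈ A) ∧ gdet o ≤ (β ^ 2) ^ m * gdet o' by
    obtain ⟨o', h1, -, h2⟩ := H k le_rfl
    exact ⟨o', fun i => h1 i i.2, h2⟩
  intro m
  induction m with
  | zero => exact fun _ => ⟨o, by simp, fun i _ => ho i, by simp⟩
  | succ m ih =>
    intro hm
    obtain ⟨o', h1, h2, h3⟩ := ih (by omega)
    obtain ⟨k, rfl⟩ : ∃ k', k = k' + 1 := ⟨k - 1, by omega⟩
    set i : Fin (k + 1) := ⟨m, hm⟩
    set W := Submodule.span ℝ (o' '' {j | j ≠ i})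
    have h4 : gdet o' = distTo W (o' i) ^ 2 * gdet (o' ∘ i.succAbove) := by
      conv_lhs => rw [← Function.update_eq_self i o', gdet_update]
    -- By `h3` the current determinant is still nonzero, so the vector to be exchanged lies off the
    -- span of the others.
    have h5 : 0 < distTo W (o' i) := by
      refine lt_of_le_of_ne (distTo_nonneg _ _) fun h0 => ?_
      rw [h4, ← h0] at h3
      simp at h3
      linarith
    obtain ⟨c, hc, hle⟩ := h W (finrank_span_image_ne_lt o' i) _ (h2 i le_rfl) h5
    refine ⟨Function.update o' i c, ?_, ?_, ?_⟩
    · intro j hj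
      rcases eq_or_ne j i with rfl | hji
      · simpa using hc
      · rw [Function.update_of_ne hji]
        refine h1 j ?_
        have : (j : ℕ) ≠ m := fun hh => hji (Fin.ext hh)
        omega
    · intro j hj
      rw [Function.update_of_ne]
      · exact h2 j (by omega)
      · rintro rfl
        simp [i] at hj
    · rw [gdet_update]
      have h6 : distTo W (o' i) ^ 2 ≤ β ^ 2 * distTo W c ^ 2 := by
        rw [← mul_pow]
        exact pow_le_pow_left₀ h5.le hle 2
      calc gdet o ≤ (β ^ 2) ^ m * gdet o' := h3
        _ = (β ^ 2) ^ m * gdet (o' ∘ i.succAbove) * distTo W (o' i) ^ 2 := by rw [h4]; ring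
        _ ≤ (β ^ 2) ^ m * gdet (o' ∘ i.succAbove) * (β ^ 2 * distTo W c ^ 2) := by
          refine mul_le_mul_of_nonneg_left h6 (mul_nonneg (by positivity) (gdet_nonneg _))
        _ = _ := by ring

/-- A subspace of smaller dimension misses some unit vector of the span. -/
theorem exists_unit_mem_orthogonal {r : ℕ} {f : Fin r → E} (hf : LinearIndependent ℝ f)
    {G : Submodule ℝ E} (hG : Module.finrank ℝ G < r) :
    ∃ u ∈ Submodule.span ℝ (Set.range f), u ∈ Gᗮ ∧ ‖u‖ = 1 := by
  set S := Submodule.span ℝ (Set.range f)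
  have hS : Module.finrank ℝ S = r := by
    simpa using finrank_span_eq_card hf
  -- Projecting the span to `G` lowers the dimension, so some nonzero vector is killed; that vector
  -- is orthogonal to `G`.
  let φ : S →ₗ[ℝ] G := G.orthogonalProjectionOnto.toLinearMap ∘ₗ S.subtype
  have hφ : ¬ Function.Injective φ := fun hi => by
    have := LinearMap.finrank_le_finrank_of_injective hi
    omega
  rw [← LinearMap.ker_eq_bot, Submodule.eq_bot_iff] at hφ
  push Not at hφ
  obtain ⟨x, hx, hx0⟩ := hφ
  have hx1 : (x : E) ∈ Gᗮ := by
    rw [← Submodule.orthogonalProjectionOnto_eq_zero_iff]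
    simpa [φ] using hx
  have hn : ‖(x : E)‖ ≠ 0 := by simpa using hx0
  refine ⟨‖(x : E)‖⁻¹ • (x : E), S.smul_mem _ x.2, Gᗮ.smul_mem _ hx1, ?_⟩
  rw [norm_smul, norm_inv, norm_norm, inv_mul_cancel₀ hn]

/-- Control of the distances to `G` by those of a family `f` with a dual family `p`. -/
theorem distTo_le_sum {r : ℕ} {f p : Fin r → E} (hf : LinearIndependent ℝ f)
    (hp : ∀ i, p i ≠ 0) (hpf : ∀ i j, j ≠ i → inner ℝ (p i) (f j) = 0)
    (hpp : ∀ i, inner ℝ (p i) (f i) = ‖p i‖ ^ 2) {A : ℝ} {a : Fin r → ℝ}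
    {v : E} (ha : ∀ i, |a i| ≤ A) (hA : ∀ i, ‖v - ∑ j, a j • f j‖ ≤ A * ‖p i‖)
    {G : Submodule ℝ E} (hG : v - ∑ j, a j • f j = 0 ∨ Module.finrank ℝ G < r) :
    distTo G v ≤ 2 * A * ∑ i, distTo G (f i) := by
  set R := v - ∑ j, a j • f j with hR
  have hv : v = ∑ j, a j • f j + R := by rw [hR]; abel
  have h1 : distTo G (∑ j, a j • f j) ≤ A * ∑ i, distTo G (f i) := by
    refine (distTo_sum_le _ _ _).trans ?_
    rw [Finset.mul_sum]
    refine Finset.sum_le_sum fun i _ => ?_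
    rw [distTo_smul]
    exact mul_le_mul_of_nonneg_right (ha i) (distTo_nonneg _ _)
  -- The residual `R` is compared with the `f i` through a unit vector `u` of their span orthogonal
  -- to `G`: not all `f i` can be close to `G`, since they generate `u`.
  have h2 : ‖R‖ ≤ A * ∑ i, distTo G (f i) := by
    rcases hG with h0 | hlt
    · rw [h0, norm_zero]
      exact (distTo_nonneg _ _).trans h1
    · obtain ⟨u, hu, huG, hu1⟩ := exists_unit_mem_orthogonal hf hlt
      obtain ⟨c, rfl⟩ := (Submodule.mem_span_range_iff_exists_fun ℝ).1 hu
      set u := ∑ i, c i • f i with hudef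
      have hc : ∀ i, inner ℝ (p i) u = c i * ‖p i‖ ^ 2 := fun i => by
        rw [hudef, inner_sum, Finset.sum_eq_single i]
        · rw [inner_smul_right, hpp]
        · intro j _ hj
          rw [inner_smul_right, hpf i j hj, mul_zero]
        · simp
      -- Pairing with the dual vector `p i` isolates the coefficient `c i` of the unit vector `u`.
      have hc2 : ∀ i, |c i| * ‖p i‖ ≤ 1 := fun i => by
        have h3 := abs_real_inner_le_norm (p i) u
        have h4 : 0 < ‖p i‖ := norm_pos_iff.2 (hp i)
        rw [hc, hu1, abs_mul, abs_of_nonneg (by positivity : (0 : ℝ) ≤ ‖p i‖ ^ 2)] at h3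
        refine le_of_mul_le_mul_right ?_ h4
        linarith [h3]
      have h5 : (1 : ℝ) = ∑ i, c i * inner ℝ (f i) u := by
        have : inner ℝ u u = (1 : ℝ) := by rw [real_inner_self_eq_norm_sq, hu1]; norm_num
        rw [← this]
        conv_lhs => rw [hudef]
        rw [sum_inner]
        simp only [inner_smul_left]
        simp [hudef]
      calc ‖R‖ = ∑ i, ‖R‖ * (c i * inner ℝ (f i) u) := by rw [← Finset.mul_sum, ← h5, mul_one]
        _ ≤ ∑ i, A * distTo G (f i) := by
          refine Finset.sum_le_sum fun i _ => ?_
          have h6 : |inner ℝ (f i) u| ≤ distTo G (f i) := by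
            simpa [hu1] using abs_inner_le_distTo huG (f i)
          have hA0 : 0 ≤ A := (abs_nonneg _).trans (ha i)
          calc ‖R‖ * (c i * inner ℝ (f i) u) ≤ ‖R‖ * (|c i| * |inner ℝ (f i) u|) := by
                refine mul_le_mul_of_nonneg_left ?_ (norm_nonneg _)
                rw [← abs_mul]
                exact le_abs_self _
            _ = (‖R‖ * |c i|) * |inner ℝ (f i) u| := by ring
            _ ≤ A * distTo G (f i) := by
              refine mul_le_mul ?_ h6 (abs_nonneg _) hA0
              calc ‖R‖ * |c i| ≤ A * ‖p i‖ * |c i| :=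
                    mul_le_mul_of_nonneg_right (hA i) (abs_nonneg _)
                _ = A * (|c i| * ‖p i‖) := by ring
                _ ≤ A * 1 := mul_le_mul_of_nonneg_left (hc2 i) hA0
                _ = A := mul_one A
        _ = _ := by rw [Finset.mul_sum]
  calc distTo G v ≤ distTo G (∑ j, a j • f j) + distTo G R := by
        conv_lhs => rw [hv]
        exact distTo_add_le _ _ _
    _ ≤ A * ∑ i, distTo G (f i) + A * ∑ i, distTo G (f i) :=
        add_le_add h1 ((distTo_le_norm _ _).trans h2)
    _ = _ := by ring

/-- A family whose Gram determinant cannot be quadrupled by exchanging one vector for `v`. -/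
theorem distTo_le_of_gdet_update_le {r : ℕ} {f : Fin r → E} (hpos : 0 < gdet f) {v : E}
    (hv : ∀ s, gdet (Function.update f s v) ≤ 4 * gdet f) {G : Submodule ℝ E}
    (hG : v ∈ Submodule.span ℝ (Set.range f) ∨ Module.finrank ℝ G < r) :
    distTo G v ≤ 4 * ∑ i, distTo G (f i) := by
  have hf : LinearIndependent ℝ f := gdet_ne_zero_iff.1 hpos.ne'
  set S := Submodule.span ℝ (Set.range f) with hS
  let W : Fin r → Submodule ℝ E := fun i => Submodule.span ℝ (f '' {j | j ≠ i})
  let p : Fin r → E := fun i => f i - (W i).starProjection (f i)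
  have hWS : ∀ i, W i ≤ S := fun i => Submodule.span_mono (Set.image_subset_range _ _)
  have hfS : ∀ i, f i ∈ S := fun i => Submodule.subset_span ⟨i, rfl⟩
  have hpS : ∀ i, p i ∈ S := fun i =>
    S.sub_mem (hfS i) (hWS i ((W i).starProjection_apply_mem _))
  have hpW : ∀ i, p i ∈ (W i)ᗮ := fun i => (W i).sub_starProjection_mem_orthogonal _
  have hpf : ∀ i j, j ≠ i → inner ℝ (p i) (f j) = 0 := fun i j hj =>
    (W i).starProjection_inner_eq_zero _ _ (Submodule.subset_span ⟨j, hj, rfl⟩)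
  have hpp : ∀ i, inner ℝ (p i) (f i) = ‖p i‖ ^ 2 := fun i => by
    have h1 : f i = p i + (W i).starProjection (f i) := by simp [p]
    conv_lhs => rw [h1]
    rw [inner_add_right, real_inner_self_eq_norm_sq,
      (W i).starProjection_inner_eq_zero _ _ ((W i).starProjection_apply_mem _), add_zero]
  -- Exchanging `f i` for `v` multiplies the Gram determinant by the squared ratio of their
  -- distances to `W i`; this ratio squared is at most 4.
  have hdist : ∀ i, 0 < ‖p i‖ ∧ distTo (W i) v ≤ 2 * ‖p i‖ := fun i => by
    obtain ⟨m, rfl⟩ : ∃ m, r = m + 1 := ⟨r - 1, by have := i.2; omega⟩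
    have h1 : gdet f = ‖p i‖ ^ 2 * gdet (f ∘ i.succAbove) := by
      conv_lhs => rw [← Function.update_eq_self i f, gdet_update]
      rfl
    have h2 := hv i
    have h3 := gdet_nonneg (f ∘ i.succAbove)
    rw [gdet_update] at h2
    have h4 : 0 < gdet (f ∘ i.succAbove) := by
      refine lt_of_le_of_ne h3 fun h0 => ?_
      rw [h1, ← h0] at hpos
      simp at hpos
    have h5 : 0 < ‖p i‖ := by
      refine lt_of_le_of_ne (norm_nonneg _) fun h0 => ?_
      rw [h1, ← h0] at hpos
      simp at hpos
    refine ⟨h5, ?_⟩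
    rw [h1] at h2
    have h6 : distTo (W i) v ^ 2 ≤ (2 * ‖p i‖) ^ 2 := by
      refine le_of_mul_le_mul_right ?_ h4
      calc _ ≤ _ := h2
        _ = _ := by ring
    exact le_of_sq_le_sq h6 (by positivity)
  have hproj := S.starProjection_apply_mem v
  obtain ⟨a, ha⟩ := (Submodule.mem_span_range_iff_exists_fun ℝ).1 hproj
  -- The bound 2 on the distance ratios controls both the coefficients and the residual, so `A = 2`
  -- and the final constant is `2 * 2`.
  have hmain := distTo_le_sum (p := p) (A := 2) (a := a) (v := v) (G := G) hf
    (fun i => norm_pos_iff.1 (hdist i).1) hpf hpp ?_ ?_ ?_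
  · linarith
  · intro i
    have h1 : inner ℝ v (p i) = a i * ‖p i‖ ^ 2 := by
      have h2 : inner ℝ (v - S.starProjection v) (p i) = 0 :=
        S.starProjection_inner_eq_zero v _ (hpS i)
      rw [inner_sub_left, ← ha, sum_inner, Finset.sum_eq_single i] at h2
      · rw [real_inner_smul_left, real_inner_comm (p i) (f i), hpp] at h2
        linarith
      · intro j _ hj
        rw [real_inner_smul_left, real_inner_comm, hpf i j hj, mul_zero]
      · simp
    have h3 := abs_inner_le_distTo (hpW i) v
    have h4 := (hdist i).1
    rw [h1, abs_mul, abs_of_nonneg (by positivity : (0 : ℝ) ≤ ‖p i‖ ^ 2)] at h3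
    have h5 : |a i| * ‖p i‖ ^ 2 ≤ 2 * ‖p i‖ ^ 2 := by
      refine h3.trans ?_
      nlinarith [(hdist i).2]
    exact le_of_mul_le_mul_right h5 (by positivity)
  · intro i
    rw [ha]
    -- The residual norm is the distance to the whole span, which is at most the distance to the
    -- smaller `W i`.
    exact (distTo_mono (hWS i) v).trans (hdist i).2
  · refine hG.imp_left fun h => ?_
    rw [ha, Submodule.starProjection_eq_self_iff.2 h, sub_self]

end Geometry

/-! ### Greedy selection and Gram–Schmidt -/

section Greedy

open InnerProductSpace

variable {E : Type*} [NormedAddCommGroup E] [InnerProductSpace ℝ E]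

/-- The Gram determinant of the first `m` vectors of a sequence. -/
noncomputable def headDet (f : ℕ → E) (m : ℕ) : ℝ := gdet fun i : Fin m => f i

theorem headDet_congr {f g : ℕ → E} {m : ℕ} (h : ∀ i < m, f i = g i) :
    headDet f m = headDet g m := by
  unfold headDet
  congr 1
  ext i
  exact h i i.2

theorem headDet_zero (f : ℕ → E) : headDet f 0 = 1 := by
  simp [headDet, gdet]

variable [FiniteDimensional ℝ E]

theorem headDet_succ (f : ℕ → E) (m : ℕ) :
    headDet f (m + 1) = distTo (Submodule.span ℝ (f '' Set.Iio m)) (f m) ^ 2 * headDet f m := by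
  have h1 := gdet_update (fun i : Fin (m + 1) => f i) (Fin.last m) (f m)
  have h2 : Function.update (fun i : Fin (m + 1) => f i) (Fin.last m) (f m) =
      fun i : Fin (m + 1) => f i := Function.update_eq_self (Fin.last m) _
  have h3 : (fun i : Fin (m + 1) => f i) '' {j | j ≠ Fin.last m} = f '' Set.Iio m := by
    ext x
    constructor
    · rintro ⟨j, hj, rfl⟩
      exact ⟨j, Fin.val_lt_last hj, rfl⟩
    · rintro ⟨j, hj, rfl⟩
      exact ⟨⟨j, Nat.lt_succ_of_lt hj⟩, fun h => absurd (congrArg Fin.val h) (ne_of_lt hj), rfl⟩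
  rw [h2, h3] at h1
  unfold headDet
  rw [h1]
  congr 2
  ext i
  simp

/-- Thus comparing determinants of candidate extensions amounts to comparing distances to the span
of the vectors already chosen. -/
theorem headDet_update_succ (f : ℕ → E) (m : ℕ) (v : E) :
    headDet (Function.update f m v) (m + 1) =
      distTo (Submodule.span ℝ (f '' Set.Iio m)) v ^ 2 * headDet f m := by
  have h1 : Function.update f m v '' Set.Iio m = f '' Set.Iio m :=
    Set.image_congr fun i hi => Function.update_of_ne (ne_of_lt hi) _ _
  rw [headDet_succ, h1, Function.update_self]
  congr 1
  exact headDet_congr fun i hi => Function.update_of_ne (ne_of_lt hi) _ _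

theorem distTo_span_eq_norm_gramSchmidt (f : ℕ → E) (m : ℕ) :
    distTo (Submodule.span ℝ (f '' Set.Iio m)) (f m) = ‖gramSchmidt ℝ f m‖ := by
  have h := gramSchmidt_def'' ℝ f m
  rw [← span_gramSchmidt_Iio]
  have h1 : gramSchmidt ℝ f m = f m - (f m - gramSchmidt ℝ f m) := by abel
  conv_rhs => rw [h1]
  refine distTo_eq_norm_sub ?_ ?_
  · rw [sub_eq_iff_eq_add'.2 h]
    exact Submodule.sum_mem _ fun i hi => Submodule.smul_mem _ _
      (Submodule.subset_span ⟨i, by simpa using hi, rfl⟩)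
  · rw [sub_sub_cancel, Submodule.mem_orthogonal]
    intro u hu
    induction hu using Submodule.span_induction with
    | mem x hx =>
      obtain ⟨i, hi, rfl⟩ := hx
      exact gramSchmidt_orthogonal ℝ f (ne_of_lt hi)
    | zero => simp
    | add x y _ _ hx hy => rw [inner_add_left, hx, hy, add_zero]
    | smul a x _ hx => rw [inner_smul_left, hx, mul_zero]

/-- This product is the form in which the machine evaluates the determinant. -/
theorem headDet_eq_prod (f : ℕ → E) (m : ℕ) :
    headDet f m = ∏ i ∈ Finset.range m, ‖gramSchmidt ℝ f i‖ ^ 2 := by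
  induction m with
  | zero => simp [headDet_zero]
  | succ m ih => rw [headDet_succ, distTo_span_eq_norm_gramSchmidt, ih, Finset.prod_range_succ,
      mul_comm]

theorem headDet_pos_of_le {f : ℕ → E} {m r : ℕ} (h : m ≤ r) (hr : 0 < headDet f r) :
    0 < headDet f m := by
  rw [headDet_eq_prod] at hr ⊢
  have h1 := Finset.prod_ne_zero_iff.1 hr.ne'
  refine Finset.prod_pos fun i hi => ?_
  have := h1 i (Finset.mem_range.2 ((Finset.mem_range.1 hi).trans_le h))
  positivity

/-- The guarantee for a family chosen greedily. -/
theorem distTo_le_of_greedy {f : ℕ → E} {r : ℕ} (hpos : 0 < headDet f r) {A : Set E}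
    (hfA : ∀ i < r, f i ∈ A)
    (hA : ∀ j < r, ∀ v ∈ A, headDet (Function.update f j v) (j + 1) ≤ headDet f (j + 1))
    {v : E} (hv : v ∈ A) {G : Submodule ℝ E} (hG : Module.finrank ℝ G < r) :
    ∃ i < r, distTo G v ≤ 2 ^ (r + 1) * distTo G (f i) := by
  set w := gramSchmidt ℝ f with hw
  have hwpos : ∀ j < r, 0 < ‖w j‖ := fun j hj => by
    rw [headDet_eq_prod] at hpos
    have := Finset.prod_ne_zero_iff.1 hpos.ne' j (Finset.mem_range.2 hj)
    refine lt_of_le_of_ne (norm_nonneg _) fun h => this ?_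
    rw [← h]
    norm_num
  have hdist : ∀ j < r, ∀ v ∈ A, distTo (Submodule.span ℝ (f '' Set.Iio j)) v ≤ ‖w j‖ := by
    intro j hj v hv
    have h1 := hA j hj v hv
    rw [headDet_update_succ, headDet_succ, distTo_span_eq_norm_gramSchmidt] at h1
    exact le_of_sq_le_sq (le_of_mul_le_mul_right h1 (headDet_pos_of_le hj.le hpos)) (norm_nonneg _)
  have hworth : ∀ j, w j ∈ (Submodule.span ℝ (f '' Set.Iio j))ᗮ := by
    intro j
    rw [← span_gramSchmidt_Iio, Submodule.mem_orthogonal]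
    intro u hu
    induction hu using Submodule.span_induction with
    | mem x hx =>
      obtain ⟨i, hi, rfl⟩ := hx
      exact gramSchmidt_orthogonal ℝ f (ne_of_lt hi)
    | zero => simp
    | add x y _ _ hx hy => rw [inner_add_left, hx, hy, add_zero]
    | smul a x _ hx => rw [inner_smul_left, hx, mul_zero]
  -- The greedy choice makes `w j` at least as long as the component of any `v` in `A` orthogonal to
  -- the earlier vectors.
  have hcoef : ∀ j < r, ∀ v ∈ A, |inner ℝ (w j) v / ‖w j‖ ^ 2| ≤ 1 := by
    intro j hj v hv
    have h1 := abs_inner_le_distTo (hworth j) v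
    rw [real_inner_comm] at h1
    have h2 : distTo (Submodule.span ℝ (f '' Set.Iio j)) v * ‖w j‖ ≤ ‖w j‖ ^ 2 := by
      rw [sq]
      exact mul_le_mul_of_nonneg_right (hdist j hj v hv) (norm_nonneg _)
    have h3 := hwpos j hj
    rw [abs_div, abs_of_nonneg (by positivity : (0 : ℝ) ≤ ‖w j‖ ^ 2), div_le_one (by positivity)]
    exact h1.trans h2
  have hr : 0 < r := by omega
  obtain ⟨i₀, hi₀, hmax⟩ := Finset.exists_max_image (Finset.range r) (fun i => distTo G (f i))
    ⟨0, Finset.mem_range.2 hr⟩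
  refine ⟨i₀, Finset.mem_range.1 hi₀, ?_⟩
  set M := distTo G (f i₀) with hM
  -- Since `w j` is `f j` plus earlier `w i` with coefficients at most 1 in absolute value, the
  -- bound obeys `M + ∑ i < j, 2 ^ i * M = 2 ^ j * M`.
  have hN : ∀ j, j < r → distTo G (w j) ≤ 2 ^ j * M := by
    intro j
    induction j using Nat.strong_induction_on with
    | _ j ih =>
      intro hj
      have h1 : w j = f j + ∑ i ∈ Finset.range j,
          (-(inner ℝ (w i) (f j) / ‖w i‖ ^ 2)) • w i := by
        have h := gramSchmidt_def'' ℝ f j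
        rw [Nat.Iio_eq_range] at h
        simp only [neg_smul, Finset.sum_neg_distrib]
        rw [← sub_eq_add_neg, eq_sub_iff_add_eq]
        exact h.symm
      rw [h1]
      have h2 : ∀ i ∈ Finset.range j,
          distTo G ((-(inner ℝ (w i) (f j) / ‖w i‖ ^ 2)) • w i) ≤ 2 ^ i * M := by
        intro i hi
        have hij := Finset.mem_range.1 hi
        rw [distTo_smul, abs_neg]
        calc _ ≤ 1 * distTo G (w i) := mul_le_mul_of_nonneg_right
              (hcoef i (hij.trans hj) _ (hfA j hj)) (distTo_nonneg _ _)
          _ ≤ _ := by rw [one_mul]; exact ih i hij (hij.trans hj)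
      have h3 : ∑ i ∈ Finset.range j, (2 : ℝ) ^ i = 2 ^ j - 1 := by
        rw [geom_sum_eq (by norm_num)]
        norm_num
      calc _ ≤ distTo G (f j) + ∑ i ∈ Finset.range j, 2 ^ i * M :=
            (distTo_add_le _ _ _).trans (add_le_add le_rfl
              ((distTo_sum_le _ _ _).trans (Finset.sum_le_sum h2)))
        _ ≤ M + (2 ^ j - 1) * M := by
            rw [← Finset.sum_mul, h3]
            exact add_le_add (hmax j (Finset.mem_range.2 hj)) le_rfl
        _ = _ := by ring
  let wr : Fin r → E := fun i => w i
  have hort : ∀ i j : Fin r, j ≠ i → inner ℝ (wr i) (wr j) = 0 := fun i j hj =>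
    gramSchmidt_orthogonal ℝ f fun h => hj (Fin.ext h.symm)
  have hli : LinearIndependent ℝ wr :=
    linearIndependent_of_ne_zero_of_inner_eq_zero
      (fun i => norm_pos_iff.1 (hwpos i i.2)) (fun i j hij => hort i j hij.symm)
  -- An orthogonal family is its own dual family.
  have hmain := distTo_le_sum (f := wr) (p := wr) (A := 1) (v := v) (G := G)
    (a := fun i => inner ℝ (wr i) v / ‖wr i‖ ^ 2) hli (fun i => norm_pos_iff.1 (hwpos i i.2)) hort
    (fun i => real_inner_self_eq_norm_sq _) (fun i => hcoef i i.2 v hv) ?_ (Or.inr hG)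
  · have h3 : ∑ i ∈ Finset.range r, (2 : ℝ) ^ i = 2 ^ r - 1 := by
      rw [geom_sum_eq (by norm_num)]
      norm_num
    have h4 : ∑ i, distTo G (wr i) ≤ (2 ^ r - 1) * M := by
      rw [Fin.sum_univ_eq_sum_range (fun i => distTo G (w i)), ← h3, Finset.sum_mul]
      exact Finset.sum_le_sum fun i hi => hN i (Finset.mem_range.1 hi)
    have h5 : 0 ≤ M := distTo_nonneg _ _
    calc _ ≤ _ := hmain
      _ ≤ 2 * 1 * ((2 ^ r - 1) * M) := mul_le_mul_of_nonneg_left h4 (by norm_num)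
      _ = 2 ^ (r + 1) * M - 2 * M := by ring
      _ ≤ _ := by linarith
  · intro i
    rw [one_mul]
    set q := ∑ j, (inner ℝ (wr j) v / ‖wr j‖ ^ 2) • wr j with hq
    have h1 : q ∈ Submodule.span ℝ (Set.range wr) := Submodule.sum_mem _ fun j _ =>
      Submodule.smul_mem _ _ (Submodule.subset_span ⟨j, rfl⟩)
    have h2 : v - q ∈ (Submodule.span ℝ (Set.range wr))ᗮ := by
      rw [Submodule.mem_orthogonal]
      intro u hu
      induction hu using Submodule.span_induction with
      | mem x hx =>
        obtain ⟨j, rfl⟩ := hx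
        have h3 := hwpos j j.2
        rw [inner_sub_right, hq, inner_sum, Finset.sum_eq_single j]
        · rw [inner_smul_right, real_inner_self_eq_norm_sq]
          have : ‖wr j‖ ≠ 0 := h3.ne'
          field_simp
          simp
        · intro l _ hl
          rw [inner_smul_right, hort j l hl, mul_zero]
        · simp
      | zero => simp
      | add x y _ _ hx hy => rw [inner_add_left, hx, hy, add_zero]
      | smul a x _ hx => rw [inner_smul_left, hx, mul_zero]
    rw [← distTo_eq_norm_sub h1 h2]
    -- The residual is the distance to the span of all the `w j`, which contains the span of the
    -- first `i` chosen vectors, where the greedy bound applies.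
    refine (distTo_mono ?_ v).trans (hdist i i.2 v hv)
    rw [← span_gramSchmidt_Iio]
    refine Submodule.span_mono ?_
    rintro _ ⟨j, hj, rfl⟩
    exact ⟨⟨j, hj.trans i.2⟩, rfl⟩

end Greedy

/-! ### Greedy approximation ratio and distance property of local optima -/

section Coreset

variable {E : Type*} [NormedAddCommGroup E] [InnerProductSpace ℝ E]

/-- A repeated vector makes the determinant zero; otherwise `σ` is a permutation of the finite index
type. -/
theorem gdet_comp_le {ι : Type*} [Fintype ι] [DecidableEq ι] (f : ι → E) (σ : ι → ι) :
    gdet (f ∘ σ) ≤ gdet f := by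
  by_cases h : gdet (f ∘ σ) = 0
  · rw [h]
    exact gdet_nonneg f
  · have h1 : Function.Injective σ := (gdet_ne_zero_iff.1 h).injective.of_comp
    have h2 : gdet (f ∘ Equiv.ofBijective σ (Finite.injective_iff_bijective.1 h1)) = gdet f :=
      gdet_comp_equiv f _
    exact h2.le

variable [FiniteDimensional ℝ E]

/-- Greedy is exponentially close to optimal. -/
theorem gdet_le_of_greedy {f : ℕ → E} {r : ℕ} (hpos : 0 < headDet f r) {A : Set E}
    (hfA : ∀ i < r, f i ∈ A)
    (hA : ∀ j < r, ∀ v ∈ A, headDet (Function.update f j v) (j + 1) ≤ headDet f (j + 1))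
    {o : Fin r → E} (ho : ∀ i, o i ∈ A) :
    gdet o ≤ 4 ^ ((r + 1) * r) * headDet f r := by
  rcases (gdet_nonneg o).eq_or_lt with h0 | h0
  · rw [← h0]
    positivity
  -- Exchanging everything for greedy vectors yields a rearrangement of the greedy family, possibly
  -- with repetitions.
  obtain ⟨o', h1, h2⟩ := exists_gdet_le_of_distTo_le (C := {x | ∃ i < r, f i = x})
    (β := 2 ^ (r + 1))
    (fun G hG v hv _ => by
      obtain ⟨i, hi, h⟩ := distTo_le_of_greedy hpos hfA hA hv hG
      exact ⟨f i, ⟨i, hi, rfl⟩, h⟩) o ho h0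
  choose σ hσ hσ' using h1
  have h3 : o' = (fun i : Fin r => f i) ∘ fun i => (⟨σ i, hσ i⟩ : Fin r) := by
    ext i
    exact (hσ' i).symm
  have h4 : gdet o' ≤ headDet f r := by
    rw [h3]
    exact gdet_comp_le _ _
  have h5 : (((2 : ℝ) ^ (r + 1)) ^ 2) ^ r = 4 ^ ((r + 1) * r) := by
    rw [← pow_mul, ← pow_mul, show (r + 1) * (2 * r) = 2 * ((r + 1) * r) by ring, pow_mul]
    norm_num
  rw [h5] at h2
  exact h2.trans (mul_le_mul_of_nonneg_left h4 (by positivity))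

/-- `W` consists of at most `k` vectors of `V` whose Gram determinant cannot be quadrupled by
exchanging one of them, and it spans `V` if it has fewer than `k` elements. -/
def IsLocalOpt (k : ℕ) (V W : Set E) : Prop :=
  ∃ (r : ℕ) (f : Fin r → E), r ≤ k ∧ W = Set.range f ∧ (∀ i, f i ∈ V) ∧ 0 < gdet f ∧
    (∀ v ∈ V, ∀ s, gdet (Function.update f s v) ≤ 4 * gdet f) ∧
    (r = k ∨ V ⊆ Submodule.span ℝ (Set.range f))

/-- The sum of the at most `k` distances is at most `k` times the largest. With fewer than `k`
vectors, `v` is in their span, so no condition relating `G` to their number is needed. -/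
theorem IsLocalOpt.exists_distTo_le {k : ℕ} {V W : Set E} (h : IsLocalOpt k V W)
    {G : Submodule ℝ E} (hG : Module.finrank ℝ G < k) {v : E} (hv : v ∈ V)
    (hpos : 0 < distTo G v) : ∃ c ∈ W, distTo G v ≤ 4 * k * distTo G c := by
  obtain ⟨r, f, hr, rfl, -, hdet, hloc, hspan⟩ := h
  have h1 : distTo G v ≤ 4 * ∑ i, distTo G (f i) := by
    refine distTo_le_of_gdet_update_le hdet (hloc v hv) ?_
    rcases hspan with rfl | h
    · exact Or.inr hG
    · exact Or.inl (h hv)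
  rcases Nat.eq_zero_or_pos r with rfl | hr0
  · simp at h1
    linarith
  · obtain ⟨i, -, hi⟩ := Finset.exists_max_image (Finset.univ : Finset (Fin r))
      (fun i => distTo G (f i)) ⟨⟨0, hr0⟩, Finset.mem_univ _⟩
    refine ⟨f i, ⟨i, rfl⟩, h1.trans ?_⟩
    have h2 : ∑ j, distTo G (f j) ≤ r * distTo G (f i) := by
      simpa using Finset.sum_le_card_nsmul Finset.univ _ _ hi
    have h3 : (r : ℝ) * distTo G (f i) ≤ k * distTo G (f i) :=
      mul_le_mul_of_nonneg_right (by exact_mod_cast hr) (distTo_nonneg _ _)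
    linarith

end Coreset

/-! ### From local optimality to composable core-sets -/

section DetMax

variable {d : ℕ}

theorem exists_enum_gramDet {k : ℕ} {S : Finset (Pt d)} (hS : S.card = k) :
    ∃ o : Fin k → Pt d, (∀ i, o i ∈ S) ∧ gdet o = gramDet S := by
  let σ : Fin k ≃ {x // x ∈ S} := (S.equivFinOfCardEq hS).symm
  exact ⟨fun i => (σ i).1, fun i => (σ i).2, gdet_comp_equiv (fun u : {x // x ∈ S} => u.1) σ⟩

theorem detMax_nonneg (k : ℕ) (V : Finset (Pt d)) : 0 ≤ detMax k V := by
  refine Real.sSup_nonneg ?_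
  rintro _ ⟨S, -, -, rfl⟩
  exact gdet_nonneg fun u : {x // x ∈ S} => u.1

/-- A tuple of nonzero determinant is injective and so enumerates a `k`-subset; for the others
nonnegativity of the optimum suffices. -/
theorem gdet_le_detMax {k : ℕ} {V : Finset (Pt d)} {o : Fin k → Pt d} (ho : ∀ i, o i ∈ V) :
    gdet o ≤ detMax k V := by
  classical
  by_cases h : gdet o = 0
  · rw [h]
    exact detMax_nonneg k V
  have hinj := (gdet_ne_zero_iff.1 h).injective
  have hfin : {x : ℝ | ∃ S : Finset (Pt d), S ⊆ V ∧ S.card = k ∧ x = gramDet S}.Finite := by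
    refine (V.powerset.image gramDet).finite_toSet.subset ?_
    rintro _ ⟨S, hS, -, rfl⟩
    simp only [Finset.coe_image, Set.mem_image, Finset.mem_coe, Finset.mem_powerset]
    exact ⟨S, hS, rfl⟩
  have hcard : (Finset.univ.image o).card = k := by
    rw [Finset.card_image_of_injective _ hinj]
    simp
  refine le_csSup hfin.bddAbove ⟨Finset.univ.image o, ?_, hcard, ?_⟩
  · intro x hx
    obtain ⟨i, -, rfl⟩ := Finset.mem_image.1 hx
    exact ho i
  · let σ : Fin k → {x // x ∈ Finset.univ.image o} := fun i =>
      ⟨o i, Finset.mem_image_of_mem o (Finset.mem_univ i)⟩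
    have hσ : Function.Bijective σ := by
      refine ⟨fun i j hij => hinj (congrArg Subtype.val hij), ?_⟩
      rintro ⟨x, hx⟩
      obtain ⟨i, -, rfl⟩ := Finset.mem_image.1 hx
      exact ⟨i, rfl⟩
    exact gdet_comp_equiv (fun u : {x // x ∈ Finset.univ.image o} => u.1) (Equiv.ofBijective σ hσ)

/-- The distance property concerns one point at a time, so it holds for the union of the sets with
the union of their core-sets, with no loss depending on `m`. The exchange argument then costs
`(4k)^2` per vector. -/
theorem isComposableCoreset_of_isLocalOpt {k : ℕ} {c : Finset (Pt d) → Finset (Pt d)}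
    (hc : ∀ V : Finset (Pt d), IsLocalOpt k (V : Set (Pt d)) (c V : Set (Pt d))) {α : ℝ}
    (hα : ((4 * (k : ℝ)) ^ 2) ^ k ≤ α) (hα0 : 0 < α) :
    IsComposableCoreset (detMax k) α c := by
  refine ⟨fun V => ?_, fun m V => ?_⟩
  · obtain ⟨r, f, -, hW, hV, -⟩ := hc V
    intro x hx
    have hx' : x ∈ (c V : Set (Pt d)) := hx
    rw [hW] at hx'
    obtain ⟨i, rfl⟩ := hx'
    exact hV i
  · rw [ge_iff_le, one_div, inv_mul_le_iff₀ hα0]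
    refine Real.sSup_le ?_ (mul_nonneg hα0.le (detMax_nonneg _ _))
    rintro _ ⟨S, hSV, hS, rfl⟩
    obtain ⟨o, ho, ho'⟩ := exists_enum_gramDet hS
    rw [← ho']
    rcases (gdet_nonneg o).eq_or_lt with h0 | h0
    · rw [← h0]
      exact mul_nonneg hα0.le (detMax_nonneg _ _)
    obtain ⟨o', h1, h2⟩ := exists_gdet_le_of_distTo_le
      (A := {x | ∃ i, x ∈ V i}) (C := {x | ∃ i, x ∈ c (V i)}) (β := 4 * k)
      (fun G hG v ⟨i, hi⟩ hpos => by
        obtain ⟨x, hx, hle⟩ := (hc (V i)).exists_distTo_le hG hi hpos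
        exact ⟨x, ⟨i, hx⟩, hle⟩)
      o (fun i => by simpa using hSV (ho i)) h0
    calc gdet o ≤ _ := h2
      _ ≤ α * gdet o' := mul_le_mul_of_nonneg_right hα (gdet_nonneg _)
      _ ≤ _ := mul_le_mul_of_nonneg_left (gdet_le_detMax fun i => by simpa using h1 i) hα0.le

theorem IsLocalOpt.card_le {k : ℕ} {V W : Finset (Pt d)}
    (h : IsLocalOpt k (V : Set (Pt d)) (W : Set (Pt d))) : W.card ≤ k := by
  classical
  obtain ⟨r, f, hr, hW, -⟩ := h
  have h1 : W = Finset.univ.image f := by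
    rw [← Finset.coe_inj, hW]
    simp
  rw [h1]
  exact Finset.card_image_le.trans (by simpa using hr)

/-- Used to absorb the logarithms. The cube is at least `1/8`, so `128 / 8 = 16 = 4 ^ 2` is exactly
what the approximation bound needs. -/
theorem half_le_log {k : ℕ} (hk : 1 ≤ k) : 1 / 2 ≤ Real.log ((k : ℝ) + 1) := by
  have h1 : (1 : ℝ) ≤ k := by exact_mod_cast hk
  have h2 := Real.log_two_gt_d9
  have h3 : Real.log 2 ≤ Real.log ((k : ℝ) + 1) := Real.log_le_log (by norm_num) (by linarith)
  linarith

theorem approx_bound {k : ℕ} (hk : 1 ≤ k) :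
    ((4 * (k : ℝ)) ^ 2) ^ k ≤ (128 * (k : ℝ) ^ 2 * Real.log ((k : ℝ) + 1) ^ 3) ^ k := by
  have h1 := half_le_log hk
  have h2 : (1 / 2 : ℝ) ^ 3 ≤ Real.log ((k : ℝ) + 1) ^ 3 := pow_le_pow_left₀ (by norm_num) h1 3
  refine pow_le_pow_left₀ (by positivity) ?_ k
  have h3 : (0 : ℝ) ≤ (k : ℝ) ^ 2 := by positivity
  nlinarith

theorem size_bound {k : ℕ} (hk : 1 ≤ k) :
    (k : ℝ) ≤ 128 * (k : ℝ) * Real.log ((k : ℝ) + 1) ^ 2 := by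
  have h1 := half_le_log hk
  have h2 : (1 / 2 : ℝ) ^ 2 ≤ Real.log ((k : ℝ) + 1) ^ 2 := pow_le_pow_left₀ (by norm_num) h1 2
  have h3 : (0 : ℝ) ≤ k := by positivity
  nlinarith

end DetMax

namespace RealRAM

/-! ### Programs with bounded loops -/

/-- Programs in which `rep x b p` runs `p` with the register `x` counting from `0` up to the
content of the register `b`. -/
inductive ForProg where
  | skip
  | iset (x : ℕ) (e : IExp)
  | rset (x : ℕ) (e : RExp)
  | iput (a : ℕ) (i : IExp) (e : IExp)
  | rput (a : ℕ) (i j : IExp) (e : RExp)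
  | seq (p q : ForProg)
  | cond (b : BExp) (p q : ForProg)
  | rep (x b : ℕ) (p : ForProg)

@[simp] theorem setI_ireg (s : State) (x m y : ℕ) :
    (s.setI x m).ireg y = if y = x then m else s.ireg y := by
  simp [State.setI, Function.update_apply]

@[simp] theorem setI_rreg (s : State) (x m : ℕ) : (s.setI x m).rreg = s.rreg := rfl
@[simp] theorem setI_iarr (s : State) (x m : ℕ) : (s.setI x m).iarr = s.iarr := rfl
@[simp] theorem setI_rarr (s : State) (x m : ℕ) : (s.setI x m).rarr = s.rarr := rfl

@[simp] theorem setR_rreg (s : State) (x : ℕ) (r : ℝ) (y : ℕ) :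
    (s.setR x r).rreg y = if y = x then r else s.rreg y := by
  simp [State.setR, Function.update_apply]

@[simp] theorem setR_ireg (s : State) (x : ℕ) (r : ℝ) : (s.setR x r).ireg = s.ireg := rfl
@[simp] theorem setR_iarr (s : State) (x : ℕ) (r : ℝ) : (s.setR x r).iarr = s.iarr := rfl
@[simp] theorem setR_rarr (s : State) (x : ℕ) (r : ℝ) : (s.setR x r).rarr = s.rarr := rfl

@[simp] theorem putI_ireg (s : State) (a i m : ℕ) : (s.putI a i m).ireg = s.ireg := rfl
@[simp] theorem putI_rreg (s : State) (a i m : ℕ) : (s.putI a i m).rreg = s.rreg := rfl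
@[simp] theorem putI_rarr (s : State) (a i m : ℕ) : (s.putI a i m).rarr = s.rarr := rfl

@[simp] theorem putI_iarr (s : State) (a i m b : ℕ) :
    (s.putI a i m).iarr b = if b = a then Function.update (s.iarr a) i m else s.iarr b := by
  simp [State.putI, Function.update_apply]

@[simp] theorem putR_ireg (s : State) (a i j : ℕ) (r : ℝ) : (s.putR a i j r).ireg = s.ireg := rfl
@[simp] theorem putR_rreg (s : State) (a i j : ℕ) (r : ℝ) : (s.putR a i j r).rreg = s.rreg := rfl
@[simp] theorem putR_iarr (s : State) (a i j : ℕ) (r : ℝ) : (s.putR a i j r).iarr = s.iarr := rfl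

@[simp] theorem putR_rarr (s : State) (a i j : ℕ) (r : ℝ) (b i' j' : ℕ) :
    (s.putR a i j r).rarr b i' j' =
      if b = a ∧ i' = i ∧ j' = j then r else s.rarr b i' j' := by
  by_cases h1 : b = a
  · subst h1
    by_cases h2 : i' = i
    · subst h2
      simp [State.putR, Function.update_apply]
    · simp [State.putR, h2]
  · simp [State.putR, h1]

theorem putR_rarr_of_ne (s : State) (a i j : ℕ) (r : ℝ) {b : ℕ} (h : b ≠ a) :
    (s.putR a i j r).rarr b = s.rarr b := by
  simp [State.putR, h]

namespace ForProg

open Classical in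
/-- The state after running a program. -/
noncomputable def run : ForProg → State → State
  | skip, s => s
  | iset x e, s => s.setI x (e.eval s)
  | rset x e, s => s.setR x (e.eval s)
  | iput a i e, s => s.putI a (i.eval s) (e.eval s)
  | rput a i j e, s => s.putR a (i.eval s) (j.eval s) (e.eval s)
  | seq p q, s => run q (run p s)
  | cond b p q, s => if b.holds s then run p s else run q s
  | rep x b p, s => (fun t => (run p t).setI x ((run p t).ireg x + 1))^[s.ireg b] (s.setI x 0)

/-- Translation to programs of the machine. -/
def toProg : ForProg → Prog
  | skip => .skip
  | iset x e => .iset x e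
  | rset x e => .rset x e
  | iput a i e => .iput a i e
  | rput a i j e => .rput a i j e
  | seq p q => .seq p.toProg q.toProg
  | cond b p q => .cond b p.toProg q.toProg
  | rep x b p => .seq (.iset x (.const 0))
      (.loop (.ilt (.reg x) (.reg b)) (.seq p.toProg (.iset x (.add (.reg x) (.const 1)))))

open Polynomial in
/-- Bound for the running time, in terms of a bound for the loop bounds. -/
noncomputable def time : ForProg → Polynomial ℕ
  | skip => 1
  | iset _ e => C (e.size + 1)
  | rset _ e => C (e.size + 1)
  | iput _ i e => C (i.size + e.size + 1)
  | rput _ i j e => C (i.size + j.size + e.size + 1)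
  | seq p q => p.time + q.time
  | cond b p q => C (b.size + 1) + (p.time + q.time)
  | rep _ _ p => C 6 + X * (C 8 + p.time)

/-- The natural number registers that a program may change. -/
def wI : ForProg → ℕ → Bool
  | iset x _, y => x == y
  | seq p q, y => p.wI y || q.wI y
  | cond _ p q, y => p.wI y || q.wI y
  | rep x _ p, y => x == y || p.wI y
  | _, _ => false

/-- The real registers that a program may change. -/
def wR : ForProg → ℕ → Bool
  | rset x _, y => x == y
  | seq p q, y => p.wR y || q.wR y
  | cond _ p q, y => p.wR y || q.wR y
  | rep _ _ p, y => p.wR y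
  | _, _ => false

/-- The natural number arrays that a program may change. -/
def wA : ForProg → ℕ → Bool
  | iput a _ _, y => a == y
  | seq p q, y => p.wA y || q.wA y
  | cond _ p q, y => p.wA y || q.wA y
  | rep _ _ p, y => p.wA y
  | _, _ => false

/-- The real arrays that a program may change. -/
def wM : ForProg → ℕ → Bool
  | rput a _ _ _, y => a == y
  | seq p q, y => p.wM y || q.wM y
  | cond _ p q, y => p.wM y || q.wM y
  | rep _ _ p, y => p.wM y
  | _, _ => false

/-- The registers `0, 1, 2` are not changed, they are the only loop bounds, and no loop body
changes its counter. -/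
def wf : ForProg → Bool
  | iset x _ => decide (3 ≤ x)
  | seq p q => p.wf && q.wf
  | cond _ p q => p.wf && q.wf
  | rep x b p => decide (3 ≤ x) && decide (b < 3) && !p.wI x && p.wf
  | _ => true

/-- `t` agrees with `s` outside of what `p` may change. -/
structure Frame (p : ForProg) (s t : State) : Prop where
  ireg : ∀ y, p.wI y = false → t.ireg y = s.ireg y
  rreg : ∀ y, p.wR y = false → t.rreg y = s.rreg y
  iarr : ∀ y, p.wA y = false → t.iarr y = s.iarr y
  rarr : ∀ y, p.wM y = false → t.rarr y = s.rarr y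

/-- For a concrete program the side conditions of `Frame` are Boolean computations, so untouched
registers and arrays can be tracked by `rfl`. -/
theorem run_frame (p : ForProg) (s : State) : Frame p s (p.run s) := by
  induction p generalizing s with
  | skip => exact ⟨fun _ _ => rfl, fun _ _ => rfl, fun _ _ => rfl, fun _ _ => rfl⟩
  | iset x e =>
    refine ⟨fun y h => ?_, fun _ _ => rfl, fun _ _ => rfl, fun _ _ => rfl⟩
    have : y ≠ x := by rintro rfl; simp [wI] at h
    simp [run, this]
  | rset x e =>
    refine ⟨fun _ _ => rfl, fun y h => ?_, fun _ _ => rfl, fun _ _ => rfl⟩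
    have : y ≠ x := by rintro rfl; simp [wR] at h
    simp [run, this]
  | iput a i e =>
    refine ⟨fun _ _ => rfl, fun _ _ => rfl, fun y h => ?_, fun _ _ => rfl⟩
    have : y ≠ a := by rintro rfl; simp [wA] at h
    simp [run, this]
  | rput a i j e =>
    refine ⟨fun _ _ => rfl, fun _ _ => rfl, fun _ _ => rfl, fun y h => ?_⟩
    have : y ≠ a := by rintro rfl; simp [wM] at h
    exact putR_rarr_of_ne _ _ _ _ _ this
  | seq p q ihp ihq =>
    have h1 := ihp s
    have h2 := ihq (p.run s)
    refine ⟨fun y h => ?_, fun y h => ?_, fun y h => ?_, fun y h => ?_⟩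
    · simp only [wI, Bool.or_eq_false_iff] at h
      exact (h2.ireg y h.2).trans (h1.ireg y h.1)
    · simp only [wR, Bool.or_eq_false_iff] at h
      exact (h2.rreg y h.2).trans (h1.rreg y h.1)
    · simp only [wA, Bool.or_eq_false_iff] at h
      exact (h2.iarr y h.2).trans (h1.iarr y h.1)
    · simp only [wM, Bool.or_eq_false_iff] at h
      exact (h2.rarr y h.2).trans (h1.rarr y h.1)
  | cond b p q ihp ihq =>
    have h1 := ihp s
    have h2 := ihq s
    by_cases hb : b.holds s
    · simp only [run, if_pos hb]
      refine ⟨fun y h => ?_, fun y h => ?_, fun y h => ?_, fun y h => ?_⟩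
      · exact h1.ireg y (Bool.or_eq_false_iff.1 h).1
      · exact h1.rreg y (Bool.or_eq_false_iff.1 h).1
      · exact h1.iarr y (Bool.or_eq_false_iff.1 h).1
      · exact h1.rarr y (Bool.or_eq_false_iff.1 h).1
    · simp only [run, if_neg hb]
      refine ⟨fun y h => ?_, fun y h => ?_, fun y h => ?_, fun y h => ?_⟩
      · exact h2.ireg y (Bool.or_eq_false_iff.1 h).2
      · exact h2.rreg y (Bool.or_eq_false_iff.1 h).2
      · exact h2.iarr y (Bool.or_eq_false_iff.1 h).2
      · exact h2.rarr y (Bool.or_eq_false_iff.1 h).2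
  | rep x b p ih =>
    simp only [run]
    generalize s.ireg b = m
    induction m with
    | zero =>
      refine ⟨fun y h => ?_, fun _ _ => rfl, fun _ _ => rfl, fun _ _ => rfl⟩
      have : y ≠ x := by rintro rfl; simp [wI] at h
      simp [this]
    | succ m ihm =>
      rw [Function.iterate_succ_apply']
      have h1 := ih ((fun t => (run p t).setI x ((run p t).ireg x + 1))^[m] (s.setI x 0))
      refine ⟨fun y h => ?_, fun y h => ?_, fun y h => ?_, fun y h => ?_⟩
      · have h' := (Bool.or_eq_false_iff.1 h)
        have : y ≠ x := by rintro rfl; simp at h'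
        simp only [setI_ireg, if_neg this]
        exact (h1.ireg y h'.2).trans (ihm.ireg y h)
      · exact (h1.rreg y h).trans (ihm.rreg y h)
      · exact (h1.iarr y h).trans (ihm.iarr y h)
      · exact (h1.rarr y h).trans (ihm.rarr y h)

/-- Invariants of bounded loops. -/
theorem run_rep_induction {x b : ℕ} {p : ForProg} {s : State} (hx : p.wI x = false)
    (I : ℕ → State → Prop) (h0 : I 0 (s.setI x 0))
    (hstep : ∀ i t, i < s.ireg b → t.ireg x = i → Frame (rep x b p) s t → I i t →
      I (i + 1) ((p.run t).setI x (i + 1))) :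
    I (s.ireg b) ((rep x b p).run s) := by
  simp only [run]
  -- The invariant is carried together with the counter value and the frame condition, so `hstep`
  -- may use both.
  have key : ∀ m ≤ s.ireg b,
      let t := (fun t => (run p t).setI x ((run p t).ireg x + 1))^[m] (s.setI x 0)
      t.ireg x = m ∧ Frame (rep x b p) s t ∧ I m t := by
    intro m
    induction m with
    | zero =>
      intro _
      refine ⟨by simp, ⟨fun y h => ?_, fun _ _ => rfl, fun _ _ => rfl, fun _ _ => rfl⟩, h0⟩
      have : y ≠ x := by rintro rfl; simp [wI] at h
      simp [this]
    | succ m ih =>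
      intro hm
      obtain ⟨h1, h2, h3⟩ := ih (by omega)
      simp only [Function.iterate_succ_apply']
      set t := (fun t => (run p t).setI x ((run p t).ireg x + 1))^[m] (s.setI x 0)
      have h4 := run_frame p t
      have h5 : (run p t).ireg x = m := (h4.ireg x hx).trans h1
      rw [h5]
      refine ⟨by simp, ⟨fun y h => ?_, fun y h => ?_, fun y h => ?_, fun y h => ?_⟩,
        hstep m t (by omega) h1 h2 h3⟩
      · have h' := (Bool.or_eq_false_iff.1 h)
        have : y ≠ x := by rintro rfl; simp at h'
        simp only [setI_ireg, if_neg this]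
        exact (h4.ireg y h'.2).trans (h2.ireg y h)
      · exact (h4.rreg y h).trans (h2.rreg y h)
      · exact (h4.iarr y h).trans (h2.iarr y h)
      · exact (h4.rarr y h).trans (h2.rarr y h)
  exact (key _ le_rfl).2.2

theorem wI_of_wf {p : ForProg} (h : p.wf = true) {y : ℕ} (hy : y < 3) : p.wI y = false := by
  induction p with
  | iset x e =>
    simp only [wf, decide_eq_true_eq] at h
    simp only [wI, beq_eq_false_iff_ne]
    omega
  | seq p q ihp ihq =>
    simp only [wf, Bool.and_eq_true] at h
    simp [wI, ihp h.1, ihq h.2]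
  | cond b p q ihp ihq =>
    simp only [wf, Bool.and_eq_true] at h
    simp [wI, ihp h.1, ihq h.2]
  | rep x b p ih =>
    simp only [wf, Bool.and_eq_true, decide_eq_true_eq] at h
    simp only [wI, ih h.2, Bool.or_false, beq_eq_false_iff_ne]
    omega
  | _ => rfl

/-- Well-formedness keeps registers `0, 1, 2` constant, so every loop at every nesting depth runs at
most `M` times and the cost is polynomial in `M`. -/
theorem exec_run {p : ForProg} (h : p.wf = true) {M : ℕ} {s : State} (hM : ∀ y < 3, s.ireg y ≤ M) :
    ∃ t, Exec p.toProg s (p.run s) t ∧ t ≤ p.time.eval M := by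
  induction p generalizing s with
  | skip => exact ⟨1, Exec.skip s, by simp [time]⟩
  | iset x e => exact ⟨_, Exec.iset s x e, by simp [time]⟩
  | rset x e => exact ⟨_, Exec.rset s x e, by simp [time]⟩
  | iput a i e => exact ⟨_, Exec.iput s a i e, by simp [time]⟩
  | rput a i j e => exact ⟨_, Exec.rput s a i j e, by simp [time]⟩
  | seq p q ihp ihq =>
    simp only [wf, Bool.and_eq_true] at h
    obtain ⟨t, ht, hle⟩ := ihp h.1 hM
    obtain ⟨t', ht', hle'⟩ := ihq h.2 (s := p.run s) fun y hy => by
      rw [(run_frame p s).ireg y (wI_of_wf h.1 hy)]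
      exact hM y hy
    exact ⟨t + t', Exec.seq ht ht', by simpa [time] using Nat.add_le_add hle hle'⟩
  | cond b p q ihp ihq =>
    simp only [wf, Bool.and_eq_true] at h
    by_cases hb : b.holds s
    · obtain ⟨t, ht, hle⟩ := ihp h.1 hM
      simp only [run, if_pos hb]
      refine ⟨_, Exec.cond_true hb ht, ?_⟩
      simp only [time, Polynomial.eval_add, Polynomial.eval_C]
      omega
    · obtain ⟨t, ht, hle⟩ := ihq h.2 hM
      simp only [run, if_neg hb]
      refine ⟨_, Exec.cond_false hb ht, ?_⟩
      simp only [time, Polynomial.eval_add, Polynomial.eval_C]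
      omega
  | rep x b p ih =>
    simp only [wf, Bool.and_eq_true, decide_eq_true_eq, Bool.not_eq_true'] at h
    obtain ⟨⟨⟨hx, hb⟩, hpx⟩, hp⟩ := h
    set g : State → State := fun t => (run p t).setI x ((run p t).ireg x + 1) with hg
    set lp : Prog := .loop (.ilt (.reg x) (.reg b))
      (.seq p.toProg (.iset x (.add (.reg x) (.const 1)))) with hlp
    -- A round costs 4 for the test and 4 for the increment; the failing test costs 4 and resetting
    -- the counter 2. These are the constants 8 and 6 of `time`.
    have key : ∀ (m : ℕ) (u : State), (∀ y < 3, u.ireg y ≤ M) → u.ireg x + m = u.ireg b →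
        ∃ t, Exec lp u (g^[m] u) t ∧ t ≤ m * (8 + p.time.eval M) + 4 := by
      intro m
      induction m with
      | zero =>
        intro u _ hu
        have hn : ¬ (BExp.ilt (.reg x) (.reg b)).holds u := by
          simp only [BExp.holds, IExp.eval]
          omega
        refine ⟨_, Exec.loop_false hn, ?_⟩
        simp [BExp.size, IExp.size]
      | succ m ihm =>
        intro u hu hm
        have hy : (BExp.ilt (.reg x) (.reg b)).holds u := by
          simp only [BExp.holds, IExp.eval]
          omega
        obtain ⟨t, ht, hle⟩ := ih hp hu
        have hfr := run_frame p u
        have h1 : Exec (.seq p.toProg (.iset x (.add (.reg x) (.const 1)))) u (g u) (t + 4) :=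
          Exec.seq ht (Exec.iset (run p u) x (.add (.reg x) (.const 1)))
        have h2 : ∀ y < 3, (g u).ireg y = u.ireg y := fun y hy => by
          have : y ≠ x := by omega
          simp only [hg, setI_ireg, if_neg this]
          exact hfr.ireg y (wI_of_wf hp hy)
        have h3 : (g u).ireg x = u.ireg x + 1 := by
          simp [hg, hfr.ireg x hpx]
        obtain ⟨t', ht', hle'⟩ := ihm (g u) (fun y hy => (h2 y hy).le.trans (hu y hy))
          (by rw [h2 b hb, h3]; omega)
        refine ⟨_, Exec.loop_true hy h1 ht', ?_⟩
        simp only [BExp.size, IExp.size]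
        rw [Nat.succ_mul]
        omega
    obtain ⟨t, ht, hle⟩ := key (s.ireg b) (s.setI x 0)
      (fun y hy => by
        have : y ≠ x := by omega
        simpa [this] using hM y hy)
      (by
        have : b ≠ x := by omega
        simp [this])
    refine ⟨_, Exec.seq (Exec.iset s x (.const 0)) ht, ?_⟩
    have h4 : s.ireg b * (8 + p.time.eval M) ≤ M * (8 + p.time.eval M) :=
      Nat.mul_le_mul_right _ (hM b hb)
    simp only [time, Polynomial.eval_add, Polynomial.eval_C, Polynomial.eval_mul,
      Polynomial.eval_X, IExp.size]
    omega

end ForProg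

/-! ### Independence of unread arrays -/

/-- The states agree except possibly on the natural number array `1` and the real array `0`. -/
structure Agree (s t : State) : Prop where
  ireg : s.ireg = t.ireg
  rreg : s.rreg = t.rreg
  iarr : ∀ a, a ≠ 1 → s.iarr a = t.iarr a
  rarr : ∀ a, a ≠ 0 → s.rarr a = t.rarr a

/-- The expression does not read the array `1`. -/
def IExp.avoids : IExp → Bool
  | .const _ => true
  | .reg _ => true
  | .get a i => decide (a ≠ 1) && i.avoids
  | .add e f => e.avoids && f.avoids
  | .sub e f => e.avoids && f.avoids

/-- The expression reads neither the natural number array `1` nor the real array `0`. -/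
def RExp.avoids : RExp → Bool
  | .const _ => true
  | .reg _ => true
  | .get a i j => decide (a ≠ 0) && i.avoids && j.avoids
  | .add e f => e.avoids && f.avoids
  | .sub e f => e.avoids && f.avoids
  | .mul e f => e.avoids && f.avoids
  | .div e f => e.avoids && f.avoids

/-- The test reads neither the natural number array `1` nor the real array `0`. -/
def BExp.avoids : BExp → Bool
  | .ilt e f => e.avoids && f.avoids
  | .rlt e f => e.avoids && f.avoids
  | .not b => b.avoids
  | .and b c => b.avoids && c.avoids

/-- The program reads neither the natural number array `1` nor the real array `0`. -/
def ForProg.avoids : ForProg → Bool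
  | .skip => true
  | .iset _ e => e.avoids
  | .rset _ e => e.avoids
  | .iput _ i e => i.avoids && e.avoids
  | .rput _ i j e => i.avoids && j.avoids && e.avoids
  | .seq p q => p.avoids && q.avoids
  | .cond b p q => b.avoids && p.avoids && q.avoids
  | .rep _ _ p => p.avoids

theorem Agree.iexp {s t : State} (h : Agree s t) {e : IExp} (he : e.avoids = true) :
    e.eval s = e.eval t := by
  induction e with
  | const m => rfl
  | reg x => simp [IExp.eval, h.ireg]
  | get a i ih =>
    simp only [IExp.avoids, Bool.and_eq_true, decide_eq_true_eq] at he
    simp [IExp.eval, ih he.2, h.iarr a he.1]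
  | add e f ihe ihf | sub e f ihe ihf =>
    simp only [IExp.avoids, Bool.and_eq_true] at he
    simp [IExp.eval, ihe he.1, ihf he.2]

theorem Agree.rexp {s t : State} (h : Agree s t) {e : RExp} (he : e.avoids = true) :
    e.eval s = e.eval t := by
  induction e with
  | const m => rfl
  | reg x => simp [RExp.eval, h.rreg]
  | get a i j =>
    simp only [RExp.avoids, Bool.and_eq_true, decide_eq_true_eq] at he
    simp [RExp.eval, h.iexp he.1.2, h.iexp he.2, h.rarr a he.1.1]
  | add e f ihe ihf | sub e f ihe ihf | mul e f ihe ihf | div e f ihe ihf =>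
    simp only [RExp.avoids, Bool.and_eq_true] at he
    simp [RExp.eval, ihe he.1, ihf he.2]

theorem Agree.bexp {s t : State} (h : Agree s t) {b : BExp} (hb : b.avoids = true) :
    b.holds s ↔ b.holds t := by
  induction b with
  | ilt e f =>
    simp only [BExp.avoids, Bool.and_eq_true] at hb
    simp [BExp.holds, h.iexp hb.1, h.iexp hb.2]
  | rlt e f =>
    simp only [BExp.avoids, Bool.and_eq_true] at hb
    simp [BExp.holds, h.rexp hb.1, h.rexp hb.2]
  | not b ih => simp [BExp.holds, ih hb]
  | and b c ihb ihc =>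
    simp only [BExp.avoids, Bool.and_eq_true] at hb
    simp [BExp.holds, ihb hb.1, ihc hb.2]

theorem Agree.setI {s t : State} (h : Agree s t) (x m : ℕ) : Agree (s.setI x m) (t.setI x m) :=
  ⟨by simp [State.setI, h.ireg], h.rreg, h.iarr, h.rarr⟩

/-- After sorting, only the two ignored arrays, the raw input and the sorting permutation, still
depend on the order of the listing. A program that does not read them therefore makes the same
selection for every listing. -/
theorem Agree.run {p : ForProg} (hp : p.avoids = true) {s t : State} (h : Agree s t) :
    Agree (p.run s) (p.run t) := by
  induction p generalizing s t with
  | skip => exact h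
  | iset x e =>
    simp only [ForProg.run, h.iexp (e := e) hp]
    exact h.setI _ _
  | rset x e =>
    simp only [ForProg.run, h.rexp (e := e) hp]
    exact ⟨h.ireg, by simp [State.setR, h.rreg], h.iarr, h.rarr⟩
  | iput a i e =>
    simp only [ForProg.avoids, Bool.and_eq_true] at hp
    simp only [ForProg.run, h.iexp hp.1, h.iexp hp.2]
    refine ⟨h.ireg, h.rreg, fun b hb => ?_, h.rarr⟩
    by_cases hba : b = a
    · subst hba
      simp [h.iarr b hb]
    · simp [hba, h.iarr b hb]
  | rput a i j e =>
    simp only [ForProg.avoids, Bool.and_eq_true] at hp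
    simp only [ForProg.run, h.iexp hp.1.1, h.iexp hp.1.2, h.rexp hp.2]
    refine ⟨h.ireg, h.rreg, h.iarr, fun b hb => ?_⟩
    ext i' j'
    simp [h.rarr b hb]
  | seq p q ihp ihq =>
    simp only [ForProg.avoids, Bool.and_eq_true] at hp
    exact ihq hp.2 (ihp hp.1 h)
  | cond b p q ihp ihq =>
    simp only [ForProg.avoids, Bool.and_eq_true] at hp
    by_cases hb : b.holds s
    · simp only [ForProg.run, if_pos hb, if_pos ((h.bexp hp.1.1).1 hb)]
      exact ihp hp.1.2 h
    · simp only [ForProg.run, if_neg hb, if_neg (fun h' => hb ((h.bexp hp.1.1).2 h'))]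
      exact ihq hp.2 h
  | rep x b p ih =>
    simp only [ForProg.run, h.ireg]
    generalize t.ireg b = m
    induction m with
    | zero => exact h.setI x 0
    | succ m ihm =>
      simp only [Function.iterate_succ_apply']
      have h1 := ih hp ihm
      rw [h1.ireg]
      exact h1.setI _ _


open ForProg InnerProductSpace

/-! ### Computing Gram determinants

The vectors are the rows of the real array `2`, the natural number array `2` is a list of indices of
vectors and register `8` is its length. The Gram–Schmidt vectors are the rows of the real array `1`,
and the Gram determinant is computed in the real register `0`. -/

/-- Copy the vector with position `9` in the list. -/
def copyRow : ForProg :=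
  .rep 10 1 (.rput 1 (.reg 9) (.reg 10) (.get 2 (.get 2 (.reg 9)) (.reg 10)))

/-- The inner products needed for projecting to row `11`. -/
def innerProg : ForProg :=
  .seq (.rset 1 (.const 0)) (.seq (.rset 2 (.const 0)) (.rep 10 1 (.seq
    (.rset 1 (.add (.reg 1)
      (.mul (.get 1 (.reg 11) (.reg 10)) (.get 2 (.get 2 (.reg 9)) (.reg 10)))))
    (.rset 2 (.add (.reg 2)
      (.mul (.get 1 (.reg 11) (.reg 10)) (.get 1 (.reg 11) (.reg 10))))))))

/-- Subtract a multiple of row `11` from row `9`. -/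
def subRow : ForProg :=
  .rep 10 1 (.rput 1 (.reg 9) (.reg 10) (.sub (.get 1 (.reg 9) (.reg 10))
    (.mul (.div (.reg 1) (.reg 2)) (.get 1 (.reg 11) (.reg 10)))))

/-- Make row `9` orthogonal to the previous rows. -/
def projProg : ForProg :=
  .rep 11 2 (.cond (.ilt (.reg 11) (.reg 9)) (.seq innerProg subRow) .skip)

/-- The squared norm of row `9`. -/
def normProg : ForProg :=
  .seq (.rset 3 (.const 0)) (.rep 10 1 (.rset 3 (.add (.reg 3)
    (.mul (.get 1 (.reg 9) (.reg 10)) (.get 1 (.reg 9) (.reg 10))))))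

/-- One step of the Gram–Schmidt process. -/
def rowProg : ForProg :=
  .seq copyRow (.seq projProg (.seq normProg (.rset 0 (.mul (.reg 0) (.reg 3)))))

/-- The Gram determinant of the list. -/
def gramProg : ForProg :=
  .seq (.rset 0 (.const 1)) (.rep 9 2 (.cond (.ilt (.reg 9) (.reg 8)) rowProg .skip))

theorem run_copyRow (s : State) (i c : ℕ) :
    (copyRow.run s).rarr 1 i c =
      if i = s.ireg 9 ∧ c < s.ireg 1 then s.rarr 2 (s.iarr 2 (s.ireg 9)) c else s.rarr 1 i c := by
  refine run_rep_induction (x := 10) (b := 1) (s := s) rfl (fun j t => ∀ i c, t.rarr 1 i c =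
    if i = s.ireg 9 ∧ c < j then s.rarr 2 (s.iarr 2 (s.ireg 9)) c else s.rarr 1 i c) ?_ ?_ i c
  · simp
  · intro j t hj hx hf hI i c
    have h9 := hf.ireg 9 rfl
    have hA := hf.iarr 2 rfl
    have hM := hf.rarr 2 rfl
    simp only [run, IExp.eval, RExp.eval, setI_rarr, putR_rarr, hx, h9, hA, hM, hI]
    by_cases h1 : i = s.ireg 9 <;> by_cases h2 : c = j
    · simp [h1, h2]
    · have : c < j + 1 ↔ c < j := by omega
      simp [h1, h2, this]
    · simp [h1]
    · simp [h1]

theorem run_innerProg (s : State) :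
    (innerProg.run s).rreg 1 = ∑ c ∈ Finset.range (s.ireg 1),
      s.rarr 1 (s.ireg 11) c * s.rarr 2 (s.iarr 2 (s.ireg 9)) c ∧
    (innerProg.run s).rreg 2 = ∑ c ∈ Finset.range (s.ireg 1),
      s.rarr 1 (s.ireg 11) c * s.rarr 1 (s.ireg 11) c := by
  set s' := (s.setR 1 (((0 : ℚ) : ℝ))).setR 2 (((0 : ℚ) : ℝ)) with hs'
  refine run_rep_induction (x := 10) (b := 1) (s := s') rfl (fun j t =>
    t.rreg 1 = ∑ c ∈ Finset.range j,
      s.rarr 1 (s.ireg 11) c * s.rarr 2 (s.iarr 2 (s.ireg 9)) c ∧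
    t.rreg 2 = ∑ c ∈ Finset.range j, s.rarr 1 (s.ireg 11) c * s.rarr 1 (s.ireg 11) c) ?_ ?_
  · simp [hs']
  · intro j t hj hx hf hI
    have h9 := hf.ireg 9 rfl
    have h11 := hf.ireg 11 rfl
    have hA := hf.iarr 2 rfl
    have hM := hf.rarr 2 rfl
    have hM1 := hf.rarr 1 rfl
    simp only [hs', setR_ireg, setR_iarr, setR_rarr] at h9 h11 hA hM hM1
    simp [run, IExp.eval, RExp.eval, hx, h9, h11, hA, hM, hM1, hI.1, hI.2, Finset.sum_range_succ]

theorem run_subRow (s : State) (h : s.ireg 11 ≠ s.ireg 9) (i c : ℕ) :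
    (subRow.run s).rarr 1 i c =
      if i = s.ireg 9 ∧ c < s.ireg 1 then
        s.rarr 1 i c - s.rreg 1 / s.rreg 2 * s.rarr 1 (s.ireg 11) c
      else s.rarr 1 i c := by
  refine run_rep_induction (x := 10) (b := 1) (s := s) rfl (fun j t => ∀ i c, t.rarr 1 i c =
    if i = s.ireg 9 ∧ c < j then s.rarr 1 i c - s.rreg 1 / s.rreg 2 * s.rarr 1 (s.ireg 11) c
    else s.rarr 1 i c) ?_ ?_ i c
  · simp
  · intro j t hj hx hf hI i c
    have h9 := hf.ireg 9 rfl
    have h11 := hf.ireg 11 rfl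
    have hr1 := hf.rreg 1 rfl
    have hr2 := hf.rreg 2 rfl
    simp only [run, IExp.eval, RExp.eval, setI_rarr, putR_rarr, hx, h9, h11, hr1, hr2, hI]
    by_cases h1 : i = s.ireg 9 <;> by_cases h2 : c = j
    · simp [h1, h2, h]
    · have : c < j + 1 ↔ c < j := by omega
      simp [h1, h2, this]
    · simp [h1]
    · simp [h1]

theorem run_normProg (s : State) :
    (normProg.run s).rreg 3 = ∑ c ∈ Finset.range (s.ireg 1),
      s.rarr 1 (s.ireg 9) c * s.rarr 1 (s.ireg 9) c := by
  set s' := s.setR 3 (((0 : ℚ) : ℝ)) with hs'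
  refine run_rep_induction (x := 10) (b := 1) (s := s') rfl (fun j t =>
    t.rreg 3 = ∑ c ∈ Finset.range j, s.rarr 1 (s.ireg 9) c * s.rarr 1 (s.ireg 9) c) ?_ ?_
  · simp [hs']
  · intro j t hj hx hf hI
    have h9 := hf.ireg 9 rfl
    have hM1 := hf.rarr 1 rfl
    simp only [hs', setR_ireg, setR_rarr] at h9 hM1
    simp [run, IExp.eval, RExp.eval, hx, h9, hM1, hI, Finset.sum_range_succ]

theorem Pt.inner_eq_sum {d : ℕ} (x y : Pt d) : inner ℝ x y = ∑ c, x c * y c := by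
  simp [PiLp.inner_apply, mul_comm]

theorem sum_range_eq_inner {d : ℕ} {x y : Pt d} {a b : ℕ → ℝ} (ha : ∀ c : Fin d, a c = x c)
    (hb : ∀ c : Fin d, b c = y c) : ∑ c ∈ Finset.range d, a c * b c = inner ℝ x y := by
  rw [Pt.inner_eq_sum, Finset.sum_range]
  exact Finset.sum_congr rfl fun c _ => by rw [ha, hb]

theorem sum_range_eq_norm_sq {d : ℕ} {x : Pt d} {a : ℕ → ℝ} (ha : ∀ c : Fin d, a c = x c) :
    ∑ c ∈ Finset.range d, a c * a c = ‖x‖ ^ 2 := by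
  rw [sum_range_eq_inner ha ha, real_inner_self_eq_norm_sq]

/-- Each coefficient is computed from the original vector, not from the partly reduced row, which
matches `gramSchmidt_def''` term by term. A zero Gram–Schmidt vector is harmless, as division by
zero gives zero on both sides. -/
theorem run_projProg {d : ℕ} {s : State} (hd : s.ireg 1 = d) {f : ℕ → Pt d} {i : ℕ}
    (hi : s.ireg 9 = i) (hik : i ≤ s.ireg 2) (hf : ∀ c : Fin d, s.rarr 2 (s.iarr 2 i) c = f i c)
    (hprev : ∀ j < i, ∀ c : Fin d, s.rarr 1 j c = gramSchmidt ℝ f j c)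
    (hrow : ∀ c : Fin d, s.rarr 1 i c = f i c) :
    (∀ a, a ≠ i → (projProg.run s).rarr 1 a = s.rarr 1 a) ∧
      ∀ c : Fin d, (projProg.run s).rarr 1 i c = gramSchmidt ℝ f i c := by
  -- Loops may only be bounded by registers `0, 1, 2`, so this one runs `k` times and its guard
  -- idles from round `i` on; hence `min j i`.
  have key := run_rep_induction (x := 11) (b := 2) (s := s)
    (p := .cond (.ilt (.reg 11) (.reg 9)) (.seq innerProg subRow) .skip) rfl (fun j t =>
      (∀ a, a ≠ i → t.rarr 1 a = s.rarr 1 a) ∧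
      ∀ c : Fin d, t.rarr 1 i c = (f i - ∑ j' ∈ Finset.range (min j i),
        (inner ℝ (gramSchmidt ℝ f j') (f i) / ‖gramSchmidt ℝ f j'‖ ^ 2) • gramSchmidt ℝ f j') c)
    ?_ ?_
  · refine ⟨key.1, fun c => ?_⟩
    have h1 := key.2 c
    rw [min_eq_right hik] at h1
    refine h1.trans ?_
    have h2 := gramSchmidt_def'' ℝ f i
    rw [Nat.Iio_eq_range] at h2
    exact congrArg (fun x : Pt d => x c) (sub_eq_iff_eq_add.2 h2)
  · simp [hrow]
  · intro j t hj hx hfr hI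
    have h9 : t.ireg 9 = i := (hfr.ireg 9 rfl).trans hi
    have h1 : t.ireg 1 = d := (hfr.ireg 1 rfl).trans hd
    have hA := hfr.iarr 2 rfl
    have hM := hfr.rarr 2 rfl
    by_cases hji : j < i
    · have hb : (BExp.ilt (.reg 11) (.reg 9)).holds t := by
        simp [BExp.holds, IExp.eval, hx, h9, hji]
      simp only [run, if_pos hb, setI_rarr]
      have hin := run_innerProg t
      have hfi := run_frame innerProg t
      have i1 : (innerProg.run t).ireg 1 = d := (hfi.ireg 1 rfl).trans h1
      have i9 : (innerProg.run t).ireg 9 = i := (hfi.ireg 9 rfl).trans h9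
      have i11 : (innerProg.run t).ireg 11 = j := (hfi.ireg 11 rfl).trans hx
      have iM := hfi.rarr 1 rfl
      have hgj : ∀ c : Fin d, t.rarr 1 j c = gramSchmidt ℝ f j c := fun c => by
        rw [hI.1 j hji.ne]
        exact hprev j hji c
      rw [hx, h1, h9, sum_range_eq_inner (x := gramSchmidt ℝ f j) (y := f i) hgj
        (by simpa [hA, hM] using hf), sum_range_eq_norm_sq hgj] at hin
      have hsub := run_subRow (innerProg.run t) (by rw [i11, i9]; exact hji.ne)
      rw [i1, i9, i11, iM, hin.1, hin.2] at hsub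
      constructor
      · intro a ha
        rw [← hI.1 a ha]
        ext c
        simp [hsub, ha]
      · intro c
        rw [hsub, min_eq_left (by omega : j + 1 ≤ i), Finset.sum_range_succ, ← sub_sub]
        have h3 := hI.2 c
        rw [min_eq_left hji.le] at h3
        simp [h3, hgj]
    · have hb : ¬ (BExp.ilt (.reg 11) (.reg 9)).holds t := by
        simp only [BExp.holds, IExp.eval, hx, h9]
        exact hji
      simp only [run, if_neg hb, setI_rarr]
      rw [min_eq_right (by omega : i ≤ j + 1)]
      have h3 := hI
      rwa [min_eq_right (by omega : i ≤ j)] at h3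

theorem run_gramProg {d : ℕ} {s : State} (hd : s.ireg 1 = d) {e : ℕ → Pt d}
    (he : ∀ i, ∀ c : Fin d, s.rarr 2 i c = e i c) (hlen : s.ireg 8 ≤ s.ireg 2) :
    (gramProg.run s).rreg 0 = headDet (e ∘ s.iarr 2) (s.ireg 8) := by
  set f := e ∘ s.iarr 2 with hfdef
  set s' := s.setR 0 (((1 : ℚ) : ℝ)) with hs'
  have key := run_rep_induction (x := 9) (b := 2) (s := s')
    (p := .cond (.ilt (.reg 9) (.reg 8)) rowProg .skip) rfl (fun i t =>
      t.rreg 0 = headDet f (min i (s.ireg 8)) ∧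
      ∀ j < min i (s.ireg 8), ∀ c : Fin d, t.rarr 1 j c = gramSchmidt ℝ f j c) ?_ ?_
  · have h1 := key.1
    simp only [hs', setR_ireg] at h1
    rwa [min_eq_right hlen] at h1
  · simp [hs', headDet_zero]
  · intro i t hi hx hfr hI
    have h1 : t.ireg 1 = d := (hfr.ireg 1 rfl).trans hd
    have h2 : t.ireg 2 = s.ireg 2 := hfr.ireg 2 rfl
    have h8 : t.ireg 8 = s.ireg 8 := hfr.ireg 8 rfl
    have hA : t.iarr 2 = s.iarr 2 := hfr.iarr 2 rfl
    have hM : t.rarr 2 = s.rarr 2 := hfr.rarr 2 rfl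
    have hi' : i < s.ireg 2 := hi
    by_cases hil : i < s.ireg 8
    · have hb : (BExp.ilt (.reg 9) (.reg 8)).holds t := by
        simp [BExp.holds, IExp.eval, hx, h8, hil]
      simp only [run, if_pos hb]
      rw [min_eq_left (by omega : i ≤ s.ireg 8)] at hI
      rw [min_eq_left (by omega : i + 1 ≤ s.ireg 8)]
      set t1 := copyRow.run t with ht1
      have f1 := run_frame copyRow t
      have c1 := run_copyRow t
      rw [← ht1] at c1 f1
      set t2 := projProg.run t1 with ht2
      have f2 := run_frame projProg t1
      have c2 := run_projProg (s := t1) (d := d) (f := f) (i := i) ((f1.ireg 1 rfl).trans h1)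
        ((f1.ireg 9 rfl).trans hx) (by rw [f1.ireg 2 rfl, h2]; exact hi'.le)
        (fun c => by rw [f1.rarr 2 rfl, f1.iarr 2 rfl, hM, hA, he]; rfl)
        (fun j hj c => by
          rw [c1, hx, if_neg (fun h => hj.ne h.1)]
          exact hI.2 j hj c)
        (fun c => by
          rw [c1, hx, h1, if_pos ⟨rfl, c.2⟩, hM, hA, he]
          rfl)
      rw [← ht2] at c2 f2
      set t3 := normProg.run t2 with ht3
      have f3 := run_frame normProg t2
      have c3 := run_normProg t2
      rw [← ht3] at c3 f3
      have e1 : t2.ireg 1 = d := ((f2.ireg 1 rfl).trans (f1.ireg 1 rfl)).trans h1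
      have e9 : t2.ireg 9 = i := ((f2.ireg 9 rfl).trans (f1.ireg 9 rfl)).trans hx
      rw [e1, e9, sum_range_eq_norm_sq c2.2] at c3
      have hrow : rowProg.run t = t3.setR 0 (t3.rreg 0 * t3.rreg 3) := rfl
      rw [hrow]
      constructor
      · simp only [setI_rreg, setR_rreg, if_true]
        rw [c3, f3.rreg 0 rfl, f2.rreg 0 rfl, f1.rreg 0 rfl, hI.1, headDet_eq_prod,
          headDet_eq_prod, Finset.prod_range_succ]
      · intro j hj c
        simp only [setI_rarr, setR_rarr]
        rw [f3.rarr 1 rfl]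
        rcases eq_or_ne j i with rfl | hji
        · exact c2.2 c
        · rw [c2.1 j hji, c1, hx, if_neg (fun h => hji h.1)]
          exact hI.2 j (by omega) c
    · have hb : ¬ (BExp.ilt (.reg 9) (.reg 8)).holds t := by
        simp only [BExp.holds, IExp.eval, hx, h8]
        exact hil
      simp only [run, if_neg hb, setI_rarr, setI_rreg]
      rw [min_eq_right (by omega : s.ireg 8 ≤ i + 1)]
      rwa [min_eq_right (by omega : s.ireg 8 ≤ i)] at hI


/-! ### Greedy initialization and local search

Register `15` is the length of the list that is being built, and the real register `4` is its Gram
determinant. -/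

/-- Put the index in register `13` at position `12` of the list if this multiplies the determinant
by more than `q`. -/
def tryProg (q : ℚ) : ForProg :=
  .seq (.iset 14 (.get 2 (.reg 12))) (.seq (.iput 2 (.reg 12) (.reg 13)) (.seq gramProg
    (.cond (.rlt (.mul (.const q) (.reg 4)) (.reg 0)) (.rset 4 (.reg 0))
      (.iput 2 (.reg 12) (.reg 14)))))

/-- Find the best vector for extending the list. -/
def extendProg : ForProg :=
  .seq (.iset 12 (.reg 15)) (.seq (.iset 8 (.add (.reg 15) (.const 1)))
    (.seq (.rset 4 (.const 0)) (.rep 13 0 (tryProg 1))))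

/-- Extend the list by the best vector unless all vectors are in the span. -/
def greedyStep : ForProg :=
  .seq extendProg
    (.cond (.rlt (.const 0) (.reg 4)) (.iset 15 (.add (.reg 15) (.const 1))) .skip)

/-- The greedy algorithm. -/
def greedyProg : ForProg := .rep 16 2 greedyStep

/-- Try to replace each vector of the list by each input vector. -/
def scanProg : ForProg :=
  .rep 12 2 (.cond (.ilt (.reg 12) (.reg 15)) (.rep 13 0 (tryProg 4)) .skip)

/-- Local search. -/
def searchProg : ForProg :=
  .rep 16 2 (.rep 17 2 (.seq scanProg (.seq scanProg scanProg)))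

/-- Greedy initialization followed by local search. -/
def selectProg : ForProg :=
  .seq greedyProg (.seq (.iset 8 (.reg 15)) (.seq gramProg (.seq (.rset 4 (.reg 0)) searchProg)))

/-- The state holds the parameters `n, d, k` and the vectors `e`. -/
structure HasInput {d : ℕ} (n k : ℕ) (e : ℕ → Pt d) (s : State) : Prop where
  ireg_zero : s.ireg 0 = n
  ireg_one : s.ireg 1 = d
  ireg_two : s.ireg 2 = k
  rarr_two : ∀ i, ∀ c : Fin d, s.rarr 2 i c = e i c

variable {d n k : ℕ} {e : ℕ → Pt d}

theorem HasInput.of_frame {s t : State} {p : ForProg} (h : HasInput n k e s) (hf : Frame p s t)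
    (h0 : p.wI 0 = false) (h1 : p.wI 1 = false) (h2 : p.wI 2 = false) (hM : p.wM 2 = false) :
    HasInput n k e t :=
  ⟨(hf.ireg 0 h0).trans h.ireg_zero, (hf.ireg 1 h1).trans h.ireg_one,
    (hf.ireg 2 h2).trans h.ireg_two,
    fun i c => by rw [hf.rarr 2 hM, h.rarr_two]⟩

theorem run_tryProg {s : State} (h : HasInput n k e s) (hlen : s.ireg 8 ≤ k) (q : ℚ)
    {g : ℝ} (hg : g = headDet (e ∘ Function.update (s.iarr 2) (s.ireg 12) (s.ireg 13)) (s.ireg 8)) :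
    (q * s.rreg 4 < g → ((tryProg q).run s).iarr 2 =
        Function.update (s.iarr 2) (s.ireg 12) (s.ireg 13) ∧ ((tryProg q).run s).rreg 4 = g) ∧
    (¬ q * s.rreg 4 < g → ((tryProg q).run s).iarr 2 = s.iarr 2 ∧
      ((tryProg q).run s).rreg 4 = s.rreg 4) := by
  set s1 := (s.setI 14 (s.iarr 2 (s.ireg 12))).putI 2 (s.ireg 12) (s.ireg 13) with hs1
  have a1 : s1.iarr 2 = Function.update (s.iarr 2) (s.ireg 12) (s.ireg 13) := by simp [hs1]
  have c1 : (gramProg.run s1).rreg 0 = g := by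
    rw [run_gramProg (d := d) (e := e) (s := s1) (by simpa [hs1] using h.ireg_one)
      (by simpa [hs1] using h.rarr_two) (by simpa [hs1, h.ireg_two] using hlen), a1, hg]
    simp [hs1]
  have f1 := run_frame gramProg s1
  have b4 : (gramProg.run s1).rreg 4 = s.rreg 4 := f1.rreg 4 rfl
  have bA : (gramProg.run s1).iarr 2 = _ := (f1.iarr 2 rfl).trans a1
  have b12 : (gramProg.run s1).ireg 12 = s.ireg 12 := f1.ireg 12 rfl
  have b14 : (gramProg.run s1).ireg 14 = s.iarr 2 (s.ireg 12) := f1.ireg 14 rfl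
  have hrun : (tryProg q).run s = (ForProg.cond (.rlt (.mul (.const q) (.reg 4)) (.reg 0))
      (.rset 4 (.reg 0)) (.iput 2 (.reg 12) (.reg 14))).run (gramProg.run s1) := rfl
  have hiff : (BExp.rlt (.mul (.const q) (.reg 4)) (.reg 0)).holds (gramProg.run s1) ↔
      q * s.rreg 4 < g := by
    simp only [BExp.holds, RExp.eval, c1, b4]
  constructor
  · intro hlt
    rw [hrun]
    simp only [run, if_pos (hiff.2 hlt)]
    exact ⟨bA, by simp [RExp.eval, c1]⟩
  · intro hlt
    rw [hrun]
    simp only [run, if_neg (fun h => hlt (hiff.1 h))]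
    exact ⟨by simp [IExp.eval, b12, b14, bA], b4⟩

/-- The result of greedily choosing `r` of the vectors `e 0, …, e (n - 1)`. -/
structure IsGreedy (n : ℕ) (e : ℕ → Pt d) (r : ℕ) (L : ℕ → ℕ) : Prop where
  pos : 0 < headDet (e ∘ L) r
  lt : ∀ i < r, L i < n
  le : ∀ j < r, ∀ v < n, headDet (e ∘ Function.update L j v) (j + 1) ≤ headDet (e ∘ L) (j + 1)

/-- Needed because the search for an extension overwrites position `r` of the list even when nothing
is appended. -/
theorem IsGreedy.congr {r : ℕ} {L L' : ℕ → ℕ} (h : IsGreedy n e r L) (hL : ∀ i < r, L i = L' i) :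
    IsGreedy n e r L' := by
  refine ⟨?_, fun i hi => hL i hi ▸ h.lt i hi, fun j hj v hv => ?_⟩
  · rw [← headDet_congr (f := e ∘ L) (g := e ∘ L') fun i hi => congrArg e (hL i hi)]
    exact h.pos
  · rw [← headDet_congr (f := e ∘ L) (g := e ∘ L') fun i hi => congrArg e (hL i (by omega)),
      ← headDet_congr (f := e ∘ Function.update L j v)
        (g := e ∘ Function.update L' j v) fun i hi => congrArg e ?_]
    · exact h.le j hj v hv
    · simp only [Function.update_apply]
      split_ifs
      · rfl
      · exact hL i (by omega)

theorem IsGreedy.succ {r : ℕ} {L : ℕ → ℕ} (h : IsGreedy n e r L) (hlt : L r < n)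
    (hpos : 0 < headDet (e ∘ L) (r + 1))
    (hle : ∀ v < n, headDet (e ∘ Function.update L r v) (r + 1) ≤ headDet (e ∘ L) (r + 1)) :
    IsGreedy n e (r + 1) L := by
  refine ⟨hpos, fun i hi => ?_, fun j hj v hv => ?_⟩
  · rcases Nat.lt_succ_iff_lt_or_eq.1 hi with h1 | rfl
    · exact h.lt i h1
    · exact hlt
  · rcases Nat.lt_succ_iff_lt_or_eq.1 hj with h1 | rfl
    · exact h.le j h1 v hv
    · exact hle v hv

/-- With factor 1 a candidate is kept exactly when it is strictly better, so the real register `4`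
is a running maximum starting from 0. -/
theorem run_extendProg {s : State} (h : HasInput n k e s) (hlen : s.ireg 15 < k) :
    ((extendProg.run s).rreg 4 = 0 ∧ (extendProg.run s).iarr 2 = s.iarr 2 ∨
      ∃ w < n, (extendProg.run s).iarr 2 = Function.update (s.iarr 2) (s.ireg 15) w ∧
        (extendProg.run s).rreg 4 =
          headDet (e ∘ Function.update (s.iarr 2) (s.ireg 15) w) (s.ireg 15 + 1)) ∧
    ∀ v < n, headDet (e ∘ Function.update (s.iarr 2) (s.ireg 15) v) (s.ireg 15 + 1) ≤
      (extendProg.run s).rreg 4 := by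
  set L := s.iarr 2 with hL
  set r := s.ireg 15 with hr
  set s1 := ((s.setI 12 r).setI 8 (r + 1)).setR 4 (((0 : ℚ) : ℝ)) with hs1
  have h1 : HasInput n k e s1 := ⟨h.ireg_zero, h.ireg_one, h.ireg_two, h.rarr_two⟩
  have key := run_rep_induction (x := 13) (b := 0) (s := s1) (p := tryProg 1) rfl (fun v t =>
    (t.rreg 4 = 0 ∧ t.iarr 2 = L ∨ ∃ w < n, t.iarr 2 = Function.update L r w ∧
      t.rreg 4 = headDet (e ∘ Function.update L r w) (r + 1)) ∧
    ∀ v' < v, headDet (e ∘ Function.update L r v') (r + 1) ≤ t.rreg 4) ?_ ?_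
  · rw [h1.ireg_zero] at key
    exact key
  · refine ⟨Or.inl ⟨?_, rfl⟩, by simp⟩
    simp [hs1]
  · intro v t hv hx hf hI
    have h2 : HasInput n k e t := h1.of_frame hf rfl rfl rfl rfl
    have t8 : t.ireg 8 = r + 1 := hf.ireg 8 rfl
    have t12 : t.ireg 12 = r := hf.ireg 12 rfl
    have hvn : v < n := by rwa [h1.ireg_zero] at hv
    -- Earlier candidates only touched position `r`, which the new one overwrites.
    have hup : Function.update (t.iarr 2) r v = Function.update L r v := by
      rcases hI.1 with ⟨-, hA⟩ | ⟨w, -, hA, -⟩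
      · rw [hA]
      · rw [hA, Function.update_idem]
    have c := run_tryProg h2 (by rw [t8]; exact hlen) 1 rfl
    rw [t8, t12, hx, hup] at c
    simp only [Rat.cast_one, one_mul] at c
    simp only [setI_rreg, setI_iarr]
    by_cases hlt : t.rreg 4 < headDet (e ∘ Function.update L r v) (r + 1)
    · obtain ⟨c1, c2⟩ := c.1 hlt
      rw [c1, c2]
      refine ⟨Or.inr ⟨v, hvn, rfl, rfl⟩, fun v' hv' => ?_⟩
      rcases Nat.lt_succ_iff_lt_or_eq.1 hv' with h3 | rfl
      · exact (hI.2 v' h3).trans hlt.le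
      · exact le_rfl
    · obtain ⟨c1, c2⟩ := c.2 hlt
      rw [c1, c2]
      refine ⟨hI.1, fun v' hv' => ?_⟩
      rcases Nat.lt_succ_iff_lt_or_eq.1 hv' with h3 | rfl
      · exact hI.2 v' h3
      · exact not_lt.1 hlt

theorem run_greedyProg {s : State} (h : HasInput n k e s) (hr : s.ireg 15 = 0) :
    let t := greedyProg.run s
    t.ireg 15 ≤ k ∧ IsGreedy n e (t.ireg 15) (t.iarr 2) ∧ (t.ireg 15 = k ∨ ∀ v < n,
      headDet (e ∘ Function.update (t.iarr 2) (t.ireg 15) v) (t.ireg 15 + 1) ≤ 0) := by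
  have key := run_rep_induction (x := 16) (b := 2) (s := s) (p := greedyStep) rfl (fun j t =>
    t.ireg 15 ≤ j ∧ IsGreedy n e (t.ireg 15) (t.iarr 2) ∧ (t.ireg 15 = j ∨ ∀ v < n,
      headDet (e ∘ Function.update (t.iarr 2) (t.ireg 15) v) (t.ireg 15 + 1) ≤ 0)) ?_ ?_
  · rw [h.ireg_two] at key
    exact key
  · have h15 : (s.setI 16 0).ireg 15 = 0 := by simp [hr]
    refine ⟨h15.le, ?_, Or.inl h15⟩
    rw [h15]
    exact ⟨by rw [headDet_zero]; exact one_pos, by simp, by simp⟩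
  · intro j t hj hx hf hI
    obtain ⟨hrj, hgr, hor⟩ := hI
    have h1 : HasInput n k e t := h.of_frame hf rfl rfl rfl rfl
    rw [h.ireg_two] at hj
    have c := run_extendProg h1 (by omega)
    set t1 := extendProg.run t with ht1
    have f1 := run_frame extendProg t
    rw [← ht1] at f1
    set L := t.iarr 2 with hL
    set r := t.ireg 15
    have r1 : t1.ireg 15 = r := f1.ireg 15 rfl
    have hrun : greedyStep.run t = (ForProg.cond (.rlt (.const 0) (.reg 4))
      (.iset 15 (.add (.reg 15) (.const 1))) .skip).run t1 := rfl
    have hiff : (BExp.rlt (.const 0) (.reg 4)).holds t1 ↔ 0 < t1.rreg 4 := by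
      simp [BExp.holds, RExp.eval]
    have hup : ∀ v, Function.update (t1.iarr 2) r v = Function.update L r v := by
      intro v
      rcases c.1 with ⟨-, hA⟩ | ⟨w, -, hA, -⟩
      · rw [hA]
      · rw [hA, Function.update_idem]
    have hgr1 : IsGreedy n e r (t1.iarr 2) := by
      refine hgr.congr fun i hi => ?_
      rcases c.1 with ⟨-, hA⟩ | ⟨w, -, hA, -⟩
      · rw [hA]
      · rw [hA, Function.update_of_ne (by omega)]
    rw [hrun]
    by_cases hpos : 0 < t1.rreg 4
    · simp only [run, if_pos (hiff.2 hpos)]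
      simp only [setI_ireg, setI_iarr, IExp.eval, r1]
      rcases c.1 with ⟨h0, -⟩ | ⟨w, hw, hA, hval⟩
      · exact absurd h0 hpos.ne'
      · have hrj' : r = j := by
          rcases hor with h2 | h2
          · exact h2
          · have := h2 w hw
            rw [← hval] at this
            exact absurd hpos (not_lt.2 this)
        simp only [if_true, if_neg (by norm_num : (15 : ℕ) ≠ 16)]
        rw [← hA] at hval
        refine ⟨by omega, hgr1.succ ?_ ?_ ?_, Or.inl (by omega)⟩
        · rw [hA, Function.update_self]
          exact hw
        · rw [← hval]
          exact hpos
        · intro v hv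
          rw [hup, ← hval]
          exact c.2 v hv
    · simp only [run, if_neg (fun h => hpos (hiff.1 h))]
      simp only [setI_ireg, setI_iarr, if_neg (by norm_num : (15 : ℕ) ≠ 16), r1]
      refine ⟨by omega, hgr1, Or.inr fun v hv => ?_⟩
      rw [hup]
      exact (c.2 v hv).trans (not_lt.1 hpos)

/-- No exchange of one of the first `r` vectors quadruples the Gram determinant. -/
def NoSwap (n : ℕ) (e : ℕ → Pt d) (r : ℕ) (L : ℕ → ℕ) : Prop :=
  ∀ i < r, ∀ v < n, headDet (e ∘ Function.update L i v) r ≤ 4 * headDet (e ∘ L) r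

/-- The list of the state consists of the indices of `r` independent vectors. -/
structure IsList (n : ℕ) (e : ℕ → Pt d) (r : ℕ) (s : State) : Prop where
  len : s.ireg 8 = r
  len' : s.ireg 15 = r
  lt : ∀ i < r, s.iarr 2 i < n
  val : s.rreg 4 = headDet (e ∘ s.iarr 2) r
  pos : 0 < s.rreg 4

/-- Invariant of a scan that started with the list `L` and has tried the exchanges `P`. -/
def ScanInv (n : ℕ) (e : ℕ → Pt d) (r : ℕ) (L : ℕ → ℕ) (P : ℕ → ℕ → Prop) (s : State) : Prop :=
  IsList n e r s ∧
    ((s.iarr 2 = L ∧ ∀ i < r, ∀ v < n, P i v →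
        headDet (e ∘ Function.update L i v) r ≤ 4 * headDet (e ∘ L) r) ∨
      (4 * headDet (e ∘ L) r < s.rreg 4 ∧ ¬ NoSwap n e r L))

theorem ScanInv.setI {r : ℕ} {L : ℕ → ℕ} {P : ℕ → ℕ → Prop} {s : State}
    (h : ScanInv n e r L P s) {x : ℕ} (m : ℕ) (hx : 15 ≠ x) (hx' : 8 ≠ x) :
    ScanInv n e r L P (s.setI x m) :=
  ⟨⟨by simpa [hx'] using h.1.len, by simpa [hx] using h.1.len', h.1.lt, h.1.val, h.1.pos⟩, h.2⟩

theorem ScanInv.mono {r : ℕ} {L : ℕ → ℕ} {P Q : ℕ → ℕ → Prop} {s : State}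
    (h : ScanInv n e r L P s) (hPQ : ∀ i < r, ∀ v < n, Q i v → P i v) : ScanInv n e r L Q s :=
  ⟨h.1, h.2.imp_left fun h' => ⟨h'.1, fun i hi v hv hq => h'.2 i hi v hv (hPQ i hi v hv hq)⟩⟩

/-- Until an exchange is accepted the list is still `L`, so a rejection is a statement about `L`.
The first acceptance gains a factor above 4 over `L`, and later ones only increase the determinant.
-/
theorem ScanInv.tryProg {r : ℕ} {L : ℕ → ℕ} {P : ℕ → ℕ → Prop} {s : State}
    (h : ScanInv n e r L P s) (hs : HasInput n k e s) (hr : r ≤ k) (h12 : s.ireg 12 < r)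
    (h13 : s.ireg 13 < n) :
    ScanInv n e r L (fun i v => P i v ∨ i = s.ireg 12 ∧ v = s.ireg 13)
      ((tryProg 4).run s) := by
  obtain ⟨hl, hor⟩ := h
  have c := run_tryProg hs (by rw [hl.len]; exact hr) 4 rfl
  have f := run_frame (RealRAM.tryProg 4) s
  rw [hl.len] at c
  set t := (RealRAM.tryProg 4).run s
  set g := headDet (e ∘ Function.update (s.iarr 2) (s.ireg 12) (s.ireg 13)) r with hg
  have t8 : t.ireg 8 = r := (f.ireg 8 rfl).trans hl.len
  have t15 : t.ireg 15 = r := (f.ireg 15 rfl).trans hl.len'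
  have h4 : ((4 : ℚ) : ℝ) = 4 := by norm_num
  rw [h4] at c
  have hpos := hl.pos
  by_cases hlt : 4 * s.rreg 4 < g
  · obtain ⟨c1, c2⟩ := c.1 hlt
    refine ⟨⟨t8, t15, fun i hi => ?_, ?_, ?_⟩, Or.inr ⟨?_, ?_⟩⟩
    · rw [c1, Function.update_apply]
      split_ifs
      · exact h13
      · exact hl.lt i hi
    · rw [c1, c2]
    · rw [c2]
      linarith
    · rw [c2]
      rcases hor with ⟨hA, -⟩ | ⟨hlt', -⟩
      · rw [← hA, ← hl.val]
        exact hlt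
      · linarith
    · rcases hor with ⟨hA, -⟩ | ⟨-, hn⟩
      · intro hno
        have := hno _ h12 _ h13
        rw [← hA, ← hl.val] at this
        exact absurd hlt (not_lt.2 this)
      · exact hn
  · obtain ⟨c1, c2⟩ := c.2 hlt
    refine ⟨⟨t8, t15, by rw [c1]; exact hl.lt, by rw [c1, c2]; exact hl.val,
      by rw [c2]; exact hpos⟩, ?_⟩
    rw [c1, c2]
    refine hor.imp_left fun ⟨hA, hP⟩ => ⟨hA, fun i hi v hv hPv => ?_⟩
    rcases hPv with h1 | ⟨rfl, rfl⟩
    · exact hP i hi v hv h1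
    · rw [← hA, ← hl.val]
      exact not_lt.1 hlt

theorem run_scanProg {r : ℕ} {s : State} (hs : HasInput n k e s) (hl : IsList n e r s)
    (hr : r ≤ k) :
    IsList n e r (scanProg.run s) ∧
      ((scanProg.run s).iarr 2 = s.iarr 2 ∧ NoSwap n e r (s.iarr 2) ∨
        4 * s.rreg 4 < (scanProg.run s).rreg 4 ∧ ¬ NoSwap n e r (s.iarr 2)) := by
  have key := run_rep_induction (x := 12) (b := 2) (s := s)
    (p := .cond (.ilt (.reg 12) (.reg 15)) (.rep 13 0 (tryProg 4)) .skip) rfl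
    (fun j t => ScanInv n e r (s.iarr 2) (fun i _ => i < j) t) ?_ ?_
  · obtain ⟨h1, h2⟩ := key
    refine ⟨h1, ?_⟩
    rw [hl.val]
    refine h2.imp_left fun ⟨hA, hP⟩ => ⟨hA, fun i hi v hv => hP i hi v hv ?_⟩
    rw [hs.ireg_two]
    omega
  · refine ScanInv.setI ⟨hl, Or.inl ⟨rfl, ?_⟩⟩ 0 (by norm_num) (by norm_num)
    intro i _ v _ h
    exact absurd h (Nat.not_lt_zero i)
  · intro j t hj hx hf hI
    refine ScanInv.setI ?_ _ (by norm_num) (by norm_num)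
    have ht : HasInput n k e t := hs.of_frame hf rfl rfl rfl rfl
    by_cases hjr : j < r
    · have hb : (BExp.ilt (.reg 12) (.reg 15)).holds t := by
        simpa [BExp.holds, IExp.eval, hx, hI.1.len'] using hjr
      simp only [run, if_pos hb]
      have key2 := run_rep_induction (x := 13) (b := 0) (s := t) (p := tryProg 4) rfl
        (fun w u => ScanInv n e r (s.iarr 2) (fun i v => i < j ∨ i = j ∧ v < w) u) ?_ ?_
      · refine key2.mono fun i hi v hv hij => ?_
        rw [ht.ireg_zero]
        omega
      · refine ScanInv.setI (hI.mono fun i hi v hv hij => ?_) 0 (by norm_num) (by norm_num)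
        omega
      · intro w u hw hxu hfu hIu
        refine ScanInv.setI ?_ _ (by norm_num) (by norm_num)
        have hu : HasInput n k e u := ht.of_frame hfu rfl rfl rfl rfl
        have u12 : u.ireg 12 = j := (hfu.ireg 12 rfl).trans hx
        rw [ht.ireg_zero] at hw
        refine (hIu.tryProg hu hr (by omega) (by omega)).mono fun i hi v hv hij => ?_
        rw [u12, hxu]
        omega
    · have hb : ¬ (BExp.ilt (.reg 12) (.reg 15)).holds t := by
        simpa [BExp.holds, IExp.eval, hx, hI.1.len'] using not_lt.1 hjr
      simp only [run, if_neg hb]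
      exact hI.mono fun i hi v hv hij => by omega

/-- Invariant of local search after `m` scans, starting from determinant `D`. -/
def SearchInv (n k : ℕ) (e : ℕ → Pt d) (r : ℕ) (D : ℝ) (m : ℕ) (s : State) : Prop :=
  HasInput n k e s ∧ IsList n e r s ∧ (NoSwap n e r (s.iarr 2) ∨ 4 ^ m * D ≤ s.rreg 4)

theorem SearchInv.setI {r : ℕ} {D : ℝ} {m : ℕ} {s : State} (h : SearchInv n k e r D m s) {x : ℕ}
    (y : ℕ) (hx : 15 < x) : SearchInv n k e r D m (s.setI x y) := by
  obtain ⟨h1, h2, h3⟩ := h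
  have ha : ∀ z, z ≤ 15 → (s.setI x y).ireg z = s.ireg z := fun z hz => by
    rw [setI_ireg, if_neg (by omega)]
  exact ⟨⟨(ha 0 (by norm_num)).trans h1.ireg_zero, (ha 1 (by norm_num)).trans h1.ireg_one,
    (ha 2 (by norm_num)).trans h1.ireg_two, h1.rarr_two⟩, ⟨(ha 8 (by norm_num)).trans h2.len,
    (ha 15 (by norm_num)).trans h2.len', h2.lt, h2.val, h2.pos⟩, h3⟩

/-- At a local optimum a scan changes nothing; otherwise it more than quadruples the determinant.
Hence a fixed number of scans can be run without a stopping test. -/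
theorem SearchInv.scan {r : ℕ} {D : ℝ} {m : ℕ} {s : State} (h : SearchInv n k e r D m s)
    (hr : r ≤ k) : SearchInv n k e r D (m + 1) (scanProg.run s) := by
  obtain ⟨h1, h2, h3⟩ := h
  obtain ⟨h4, h5⟩ := run_scanProg h1 h2 hr
  refine ⟨h1.of_frame (run_frame scanProg s) rfl rfl rfl rfl, h4, ?_⟩
  rcases h5 with ⟨hA, hno⟩ | ⟨hlt, hno⟩
  · left
    rw [hA]
    exact hno
  · right
    have h6 := h3.resolve_left hno
    rw [pow_succ]
    linarith

theorem run_searchProg {r : ℕ} {s : State} (hs : HasInput n k e s) (hl : IsList n e r s)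
    (hr : r ≤ k) :
    SearchInv n k e r (s.rreg 4) (3 * (k * k)) (searchProg.run s) := by
  have key := run_rep_induction (x := 16) (b := 2) (s := s)
    (p := .rep 17 2 (.seq scanProg (.seq scanProg scanProg))) rfl
    (fun a t => SearchInv n k e r (s.rreg 4) (3 * (a * k)) t) ?_ ?_
  · rw [hs.ireg_two] at key
    exact key
  · exact SearchInv.setI ⟨hs, hl, Or.inr (by simp)⟩ 0 (by norm_num)
  · intro a t ha hx hf hI
    refine SearchInv.setI ?_ _ (by norm_num)
    have key2 := run_rep_induction (x := 17) (b := 2) (s := t)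
      (p := .seq scanProg (.seq scanProg scanProg)) rfl
      (fun b u => SearchInv n k e r (s.rreg 4) (3 * (a * k + b)) u) ?_ ?_
    · rw [hI.1.ireg_two] at key2
      rw [Nat.succ_mul a k]
      exact key2
    · exact SearchInv.setI hI 0 (by norm_num)
    · intro b u hb hxu hfu hIu
      exact SearchInv.setI (((hIu.scan hr).scan hr).scan hr) _ (by norm_num)

theorem IsGreedy.headDet_le {r : ℕ} {L L' : ℕ → ℕ} (h : IsGreedy n e r L)
    (hL' : ∀ i < r, L' i < n) :
    headDet (e ∘ L') r ≤ 4 ^ ((r + 1) * r) * headDet (e ∘ L) r := by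
  refine gdet_le_of_greedy h.pos (A := e '' Set.Iio n) (fun i hi => ⟨L i, h.lt i hi, rfl⟩) ?_
    (fun i => ⟨L' i, hL' i i.2, rfl⟩)
  rintro j hj _ ⟨v, hv, rfl⟩
  rw [← Function.comp_update]
  exact h.le j hj v hv

/-- The determinant of the extension is the squared distance to the span times a positive number. -/
theorem IsGreedy.mem_span {r : ℕ} {L : ℕ → ℕ} (h : IsGreedy n e r L) {v : ℕ}
    (hv : headDet (e ∘ Function.update L r v) (r + 1) ≤ 0) :
    e v ∈ Submodule.span ℝ ((e ∘ L) '' Set.Iio r) := by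
  rw [Function.comp_update, headDet_update_succ] at hv
  set W := Submodule.span ℝ ((e ∘ L) '' Set.Iio r)
  have h1 : distTo W (e v) ^ 2 = 0 :=
    le_antisymm (nonpos_of_mul_nonpos_left hv h.pos) (sq_nonneg _)
  have h2 : e v - W.starProjection (e v) = 0 := norm_eq_zero.1 (pow_eq_zero_iff two_ne_zero |>.1 h1)
  rw [sub_eq_zero.1 h2]
  exact W.starProjection_apply_mem _

theorem run_selectProg {s : State} (h : HasInput n k e s) (hr : s.ireg 15 = 0) (hk : 1 ≤ k) :
    let t := selectProg.run s
    (∀ i < t.ireg 15, t.iarr 2 i < n) ∧ 0 < headDet (e ∘ t.iarr 2) (t.ireg 15) ∧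
      t.ireg 15 ≤ k ∧
      IsLocalOpt k (e '' Set.Iio n) ((e ∘ t.iarr 2) '' Set.Iio (t.ireg 15)) := by
  intro t
  obtain ⟨g1, g2, g3⟩ := run_greedyProg h hr
  have gi : HasInput n k e (greedyProg.run s) :=
    h.of_frame (run_frame greedyProg s) rfl rfl rfl rfl
  set s1 := greedyProg.run s
  set r := s1.ireg 15
  set L₀ := s1.iarr 2
  set s2 := s1.setI 8 r with hs2
  have i2 : HasInput n k e s2 := ⟨gi.ireg_zero, gi.ireg_one, gi.ireg_two, gi.rarr_two⟩
  have c2 := run_gramProg i2.ireg_one i2.rarr_two (by rw [i2.ireg_two]; simpa [hs2] using g1)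
  have f2 := run_frame gramProg s2
  have i3 : HasInput n k e (gramProg.run s2) := i2.of_frame f2 rfl rfl rfl rfl
  set s3 := gramProg.run s2
  set s4 := s3.setR 4 (s3.rreg 0) with hs4
  have i4 : HasInput n k e s4 := ⟨i3.ireg_zero, i3.ireg_one, i3.ireg_two, i3.rarr_two⟩
  have A4 : s4.iarr 2 = L₀ := f2.iarr 2 rfl
  have v4 : s4.rreg 4 = headDet (e ∘ L₀) r := by
    simp only [hs4, setR_rreg, if_true, c2]
    rfl
  have l4 : IsList n e r s4 :=
    ⟨f2.ireg 8 rfl, f2.ireg 15 rfl, by rw [A4]; exact g2.lt, by rw [v4, A4],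
      by rw [v4]; exact g2.pos⟩
  obtain ⟨i5, l5, h5⟩ : SearchInv n k e r (s4.rreg 4) (3 * (k * k)) t := run_searchProg i4 l4 g1
  rw [v4] at h5
  -- Otherwise the determinant grew by `4 ^ (3k²)`, while greedy leaves room only for `4 ^
  -- ((r+1)r)`, and `(r+1)r ≤ k² + k ≤ 2k² < 3k²`.
  have hno : NoSwap n e r (t.iarr 2) := by
    refine h5.resolve_right fun hle => ?_
    rw [l5.val] at hle
    have h6 := hle.trans (g2.headDet_le l5.lt)
    have h7 := le_of_mul_le_mul_right h6 g2.pos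
    rw [pow_le_pow_iff_right₀ (by norm_num)] at h7
    have h8 : (r + 1) * r ≤ (k + 1) * k := Nat.mul_le_mul (by omega) g1
    have h9 : k ≤ k * k := Nat.le_mul_of_pos_left k hk
    have h10 : (k + 1) * k = k * k + k := Nat.succ_mul k k
    omega
  have hpos : 0 < headDet (e ∘ t.iarr 2) r := by
    rw [← l5.val]
    exact l5.pos
  rw [l5.len']
  refine ⟨l5.lt, hpos, g1, r, fun i => e (t.iarr 2 i), g1, ?_, ?_, hpos, ?_, ?_⟩
  · ext x
    constructor
    · rintro ⟨i, hi, rfl⟩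
      exact ⟨⟨i, hi⟩, rfl⟩
    · rintro ⟨i, rfl⟩
      exact ⟨i, i.2, rfl⟩
  · exact fun i => ⟨_, l5.lt i i.2, rfl⟩
  · rintro _ ⟨v, hv, rfl⟩ i
    have h6 := hno i i.2 v hv
    refine le_trans (le_of_eq (congrArg gdet (funext fun j => ?_))) h6
    simp only [Function.comp_apply, Function.update_apply, Fin.ext_iff]
    split_ifs <;> rfl
  -- If greedy stalled, its span `W` has dimension at most `r` and contains all inputs. Local search
  -- ends with `r` independent vectors of `W`, so they span `W` as well.
  · refine g3.imp_right fun hst => ?_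
    have hli : LinearIndependent ℝ fun i : Fin r => e (t.iarr 2 i) := gdet_ne_zero_iff.1 hpos.ne'
    set U := Submodule.span ℝ (Set.range fun i : Fin r => e (t.iarr 2 i))
    set W := Submodule.span ℝ ((e ∘ L₀) '' Set.Iio r) with hW
    have hU : Module.finrank ℝ U = r := by simpa using finrank_span_eq_card hli
    have hVW : ∀ v < n, e v ∈ W := fun v hv => g2.mem_span (hst v hv)
    have hUW : U ≤ W := by
      refine Submodule.span_le.2 ?_
      rintro _ ⟨i, rfl⟩
      exact hVW _ (l5.lt i i.2)
    have hWr : Module.finrank ℝ W ≤ r := by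
      classical
      have h6 : (e ∘ L₀) '' Set.Iio r = ((Finset.range r).image (e ∘ L₀) : Finset (Pt d)) := by
        simp
      rw [hW, h6]
      refine (finrank_span_finset_le_card _).trans (Finset.card_image_le.trans ?_)
      simp
    have hEq : U = W := Submodule.eq_of_le_of_finrank_le hUW (by omega)
    rintro _ ⟨v, hv, rfl⟩
    rw [SetLike.mem_coe, hEq]
    exact hVW v hv


/-! ### Canonical enumeration of a finite set -/

/-- The sequences agree with `x` smaller than `y` at the last of the first `m` positions where they
differ. -/
def ColexLT (x y : ℕ → ℝ) : ℕ → Prop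
  | 0 => False
  | c + 1 => x c < y c ∨ ¬ y c < x c ∧ ColexLT x y c

theorem ColexLT.irrefl (x : ℕ → ℝ) (m : ℕ) : ¬ ColexLT x x m := by
  induction m with
  | zero => exact id
  | succ m ih => simp [ColexLT, ih]

theorem ColexLT.trans {x y z : ℕ → ℝ} {m : ℕ} (h : ColexLT x y m) (h' : ColexLT y z m) :
    ColexLT x z m := by
  induction m with
  | zero => exact h
  | succ m ih =>
    simp only [ColexLT] at h h' ⊢
    rcases h with h | ⟨h1, h2⟩ <;> rcases h' with h' | ⟨h3, h4⟩
    · exact Or.inl (h.trans h')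
    · exact Or.inl (h.trans_le (not_lt.1 h3))
    · exact Or.inl ((not_lt.1 h1).trans_lt h')
    · exact Or.inr ⟨not_lt.2 ((not_lt.1 h1).trans (not_lt.1 h3)), ih h2 h4⟩

theorem ColexLT.trichotomy (x y : ℕ → ℝ) (m : ℕ) :
    (∀ c < m, x c = y c) ∨ ColexLT x y m ∨ ColexLT y x m := by
  induction m with
  | zero => simp
  | succ m ih =>
    simp only [ColexLT]
    rcases lt_trichotomy (x m) (y m) with h | h | h
    · exact Or.inr (Or.inl (Or.inl h))
    · rcases ih with h1 | h1 | h1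
      · refine Or.inl fun c hc => ?_
        rcases Nat.lt_succ_iff_lt_or_eq.1 hc with h2 | rfl
        · exact h1 c h2
        · exact h
      · exact Or.inr (Or.inl (Or.inr ⟨h.le.not_gt, h1⟩))
      · exact Or.inr (Or.inr (Or.inr ⟨h.ge.not_gt, h1⟩))
    · exact Or.inr (Or.inr (Or.inl h))

variable {d : ℕ}

/-- The sequence of the coordinates, extended by zero. -/
noncomputable def coords (x : Pt d) (c : ℕ) : ℝ := if h : c < d then x ⟨c, h⟩ else 0

theorem coords_val (x : Pt d) (c : Fin d) : coords x c = x c := by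
  simp [coords]

theorem coords_zero (c : ℕ) : coords (0 : Pt d) c = 0 := by
  simp [coords]

theorem coords_injective {x y : Pt d} (h : ∀ c < d, coords x c = coords y c) : x = y := by
  ext c
  rw [← coords_val, ← coords_val, h c c.2]

open Classical in
/-- The number of smaller elements. -/
noncomputable def rank (V : Finset (Pt d)) (w : Pt d) : ℕ :=
  (V.filter fun u => ColexLT (coords u) (coords w) d).card

theorem rank_lt_card {V : Finset (Pt d)} {w : Pt d} (hw : w ∈ V) : rank V w < V.card := by
  classical
  refine Finset.card_lt_card (Finset.filter_ssubset.2 ⟨w, hw, ColexLT.irrefl _ _⟩)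

theorem rank_lt_rank {V : Finset (Pt d)} {u w : Pt d} (hu : u ∈ V)
    (h : ColexLT (coords u) (coords w) d) : rank V u < rank V w := by
  classical
  refine Finset.card_lt_card (Finset.ssubset_iff_of_subset ?_ |>.2 ⟨u, ?_, ?_⟩)
  · intro x hx
    rw [Finset.mem_filter] at hx ⊢
    exact ⟨hx.1, hx.2.trans h⟩
  · exact Finset.mem_filter.2 ⟨hu, h⟩
  · simp [ColexLT.irrefl]

theorem rank_injOn (V : Finset (Pt d)) : Set.InjOn (rank V) V := by
  intro u hu w hw h
  rcases ColexLT.trichotomy (coords u) (coords w) d with h1 | h1 | h1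
  · exact coords_injective h1
  · exact absurd h (rank_lt_rank hu h1).ne
  · exact absurd h (rank_lt_rank hw h1).ne'

theorem exists_rank_eq {V : Finset (Pt d)} {j : ℕ} (hj : j < V.card) :
    ∃ w ∈ V, rank V w = j := by
  have h1 : V.image (rank V) = Finset.range V.card := by
    refine Finset.eq_of_subset_of_card_le ?_ ?_
    · intro x hx
      obtain ⟨w, hw, rfl⟩ := Finset.mem_image.1 hx
      exact Finset.mem_range.2 (rank_lt_card hw)
    · rw [Finset.card_image_of_injOn (rank_injOn V), Finset.card_range]
  have h2 : j ∈ V.image (rank V) := h1 ▸ Finset.mem_range.2 hj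
  simpa using h2

open Classical in
/-- The `j`-th element of `V`. -/
noncomputable def enum (V : Finset (Pt d)) (j : ℕ) : Pt d :=
  if h : ∃ w ∈ V, rank V w = j then h.choose else 0

theorem enum_rank {V : Finset (Pt d)} {w : Pt d} (hw : w ∈ V) : enum V (rank V w) = w := by
  have h : ∃ u ∈ V, rank V u = rank V w := ⟨w, hw, rfl⟩
  rw [enum, dif_pos h]
  exact rank_injOn V h.choose_spec.1 hw h.choose_spec.2

/-- The default value 0 agrees with the rows of the real array `2` that are never written. -/
theorem enum_of_card_le {V : Finset (Pt d)} {j : ℕ} (hj : V.card ≤ j) : enum V j = 0 := by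
  refine dif_neg ?_
  rintro ⟨w, hw, rfl⟩
  exact absurd (rank_lt_card hw) (not_lt.2 hj)

theorem image_enum (V : Finset (Pt d)) : enum V '' Set.Iio V.card = V := by
  ext w
  constructor
  · rintro ⟨j, hj, rfl⟩
    obtain ⟨w, hw, rfl⟩ := exists_rank_eq hj
    rw [enum_rank hw]
    exact hw
  · intro hw
    exact ⟨rank V w, rank_lt_card hw, enum_rank hw⟩

/-! ### Sorting the input -/

/-- Compare the vectors with indices in the registers `4` and `3`. -/
def lessProg : ForProg :=
  .seq (.iset 5 (.const 0)) (.rep 6 1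
    (.cond (.rlt (.get 0 (.reg 4) (.reg 6)) (.get 0 (.reg 3) (.reg 6))) (.iset 5 (.const 1))
      (.cond (.rlt (.get 0 (.reg 3) (.reg 6)) (.get 0 (.reg 4) (.reg 6))) (.iset 5 (.const 0))
        .skip)))

/-- Count the vectors that are smaller than the one with index in register `3`. -/
def rankProg : ForProg :=
  .seq (.iset 7 (.const 0)) (.rep 4 0 (.seq lessProg (.iset 7 (.add (.reg 7) (.reg 5)))))

/-- Compute the sorting permutation in the array `1`. -/
def sortProg : ForProg := .rep 3 0 (.seq rankProg (.iput 1 (.reg 7) (.reg 3)))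

/-- Copy the sorted vectors to the array `2`. -/
def copyProg : ForProg :=
  .rep 3 0 (.rep 4 1 (.rput 2 (.reg 3) (.reg 4) (.get 0 (.get 1 (.reg 3)) (.reg 4))))

/-- Clear the registers used for sorting. -/
def clearProg : ForProg :=
  .seq (.iset 3 (.const 0)) (.seq (.iset 4 (.const 0)) (.seq (.iset 5 (.const 0))
    (.seq (.iset 6 (.const 0)) (.iset 7 (.const 0)))))

open Classical in
-- Coordinates are read in increasing order and each strict comparison overrides the earlier
-- verdict, so the last difference decides; this is why the order is colexicographic.
theorem run_lessProg (s : State) : (lessProg.run s).ireg 5 =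
    if ColexLT (s.rarr 0 (s.ireg 4)) (s.rarr 0 (s.ireg 3)) (s.ireg 1) then 1 else 0 := by
  set s' := s.setI 5 0 with hs'
  refine run_rep_induction (x := 6) (b := 1) (s := s') rfl (fun c t => t.ireg 5 =
    if ColexLT (s.rarr 0 (s.ireg 4)) (s.rarr 0 (s.ireg 3)) c then 1 else 0) ?_ ?_
  · simp [hs', ColexLT]
  · intro c t hc hx hf hI
    have h3 : t.ireg 3 = s.ireg 3 := hf.ireg 3 rfl
    have h4 : t.ireg 4 = s.ireg 4 := hf.ireg 4 rfl
    have hM : t.rarr 0 = s.rarr 0 := hf.rarr 0 rfl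
    simp only [run, BExp.holds, RExp.eval, IExp.eval, hx, h3, h4, hM, ColexLT]
    by_cases h1 : s.rarr 0 (s.ireg 4) c < s.rarr 0 (s.ireg 3) c
    · simp [h1]
    · by_cases h2 : s.rarr 0 (s.ireg 3) c < s.rarr 0 (s.ireg 4) c
      · simp [h1, h2]
      · simp [h1, h2, hI]

open Classical in
theorem run_rankProg (s : State) : (rankProg.run s).ireg 7 =
    ((Finset.range (s.ireg 0)).filter fun j =>
      ColexLT (s.rarr 0 j) (s.rarr 0 (s.ireg 3)) (s.ireg 1)).card := by
  set s' := s.setI 7 0 with hs'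
  refine run_rep_induction (x := 4) (b := 0) (s := s') rfl (fun m t => t.ireg 7 =
    ((Finset.range m).filter fun j =>
      ColexLT (s.rarr 0 j) (s.rarr 0 (s.ireg 3)) (s.ireg 1)).card) ?_ ?_
  · simp [hs']
  · intro m t hm hx hf hI
    have h1 : t.ireg 1 = s.ireg 1 := hf.ireg 1 rfl
    have h3 : t.ireg 3 = s.ireg 3 := hf.ireg 3 rfl
    have hM : t.rarr 0 = s.rarr 0 := hf.rarr 0 rfl
    have c := run_lessProg t
    have f := run_frame lessProg t
    have h7 := f.ireg 7 rfl
    rw [hx, h1, h3, hM] at c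
    simp only [run, IExp.eval, setI_ireg, if_true, c, h7, hI, Finset.range_add_one,
      Finset.filter_insert]
    by_cases hlt : ColexLT (s.rarr 0 m) (s.rarr 0 (s.ireg 3)) (s.ireg 1)
    · simp [hlt]
    · simp [hlt]

/-- The array is filled with the inverse of `R`; injectivity of `R` ensures that no entry is
overwritten. -/
theorem run_sortProg {s : State} {R : ℕ → ℕ}
    (hR : ∀ t, t.ireg 0 = s.ireg 0 → t.ireg 1 = s.ireg 1 → t.rarr 0 = s.rarr 0 →
      t.ireg 3 < s.ireg 0 → (rankProg.run t).ireg 7 = R (t.ireg 3))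
    (hinj : ∀ i < s.ireg 0, ∀ j < s.ireg 0, R i = R j → i = j) :
    ∀ i < s.ireg 0, (sortProg.run s).iarr 1 (R i) = i := by
  refine run_rep_induction (x := 3) (b := 0) (s := s) rfl
    (fun m t => ∀ i < m, t.iarr 1 (R i) = i) ?_ ?_
  · simp
  · intro m t hm hx hf hI i hi
    have c := hR t (hf.ireg 0 rfl) (hf.ireg 1 rfl) (hf.rarr 0 rfl) (by rw [hx]; exact hm)
    have f := run_frame rankProg t
    have h3 := (f.ireg 3 rfl).trans hx
    have hA := f.iarr 1 rfl
    rw [hx] at c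
    simp only [run, IExp.eval, setI_iarr, putI_iarr, if_true, c, h3, hA, Function.update_apply]
    rcases Nat.lt_succ_iff_lt_or_eq.1 hi with h1 | rfl
    · rw [if_neg fun h => h1.ne (hinj i (h1.trans hm) m hm h)]
      exact hI i h1
    · rw [if_pos rfl]

theorem run_copyProg (s : State) (i c : ℕ) : (copyProg.run s).rarr 2 i c =
    if i < s.ireg 0 ∧ c < s.ireg 1 then s.rarr 0 (s.iarr 1 i) c else s.rarr 2 i c := by
  refine run_rep_induction (x := 3) (b := 0) (s := s)
    (p := .rep 4 1 (.rput 2 (.reg 3) (.reg 4) (.get 0 (.get 1 (.reg 3)) (.reg 4)))) rfl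
    (fun m t => ∀ i c, t.rarr 2 i c =
      if i < m ∧ c < s.ireg 1 then s.rarr 0 (s.iarr 1 i) c else s.rarr 2 i c) ?_ ?_ i c
  · simp
  · intro m t hm hx hf hI
    have h1 : t.ireg 1 = s.ireg 1 := hf.ireg 1 rfl
    have hA : t.iarr 1 = s.iarr 1 := hf.iarr 1 rfl
    have hM : t.rarr 0 = s.rarr 0 := hf.rarr 0 rfl
    have key := run_rep_induction (x := 4) (b := 1) (s := t)
      (p := .rput 2 (.reg 3) (.reg 4) (.get 0 (.get 1 (.reg 3)) (.reg 4))) rfl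
      (fun l u => ∀ i c, u.rarr 2 i c =
        if i = m ∧ c < l then s.rarr 0 (s.iarr 1 i) c else t.rarr 2 i c) ?_ ?_
    · intro i c
      rw [setI_rarr, key, h1, hI]
      by_cases h2 : i = m <;> by_cases h3 : c < s.ireg 1
      · simp [h2, h3]
      · simp [h3]
      · have : i < m + 1 ↔ i < m := by omega
        simp [h2, this]
      · simp [h3]
    · simp
    · intro l u hl hxu hfu hIu i c
      have u3 : u.ireg 3 = m := (hfu.ireg 3 rfl).trans hx
      have uA : u.iarr 1 = s.iarr 1 := (hfu.iarr 1 rfl).trans hA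
      have uM : u.rarr 0 = s.rarr 0 := (hfu.rarr 0 rfl).trans hM
      simp only [run, IExp.eval, RExp.eval, setI_rarr, putR_rarr, hxu, u3, uA, uM, hIu]
      by_cases h2 : i = m <;> by_cases h3 : c = l
      · simp [h2, h3]
      · have : c < l + 1 ↔ c < l := by omega
        simp [h2, h3, this]
      · simp [h2]
      · simp [h2]

/-- Sort the input and clear the registers. -/
def prepProg : ForProg := .seq (.seq sortProg copyProg) clearProg

/-- The state in which the core-set is selected. -/
noncomputable def canonState (k : ℕ) (V : Finset (Pt d)) : State where
  ireg x := if x = 0 then V.card else if x = 1 then d else if x = 2 then k else 0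
  rreg _ := 0
  iarr _ _ := 0
  rarr a i c := if a = 2 then coords (enum V i) c else 0

theorem hasInput_canonState (k : ℕ) (V : Finset (Pt d)) :
    HasInput V.card k (enum V) (canonState k V) :=
  ⟨rfl, rfl, rfl, fun i c => by simp [canonState, coords_val]⟩

theorem rank_eq_card_filter {n : ℕ} {v : Fin n → Pt d} (hv : Function.Injective v)
    {V : Finset (Pt d)} (hV : ∀ w, w ∈ V ↔ ∃ i, v i = w) (w : Pt d) {x : ℕ → ℕ → ℝ}
    (hx : ∀ i : Fin n, x i = coords (v i)) [DecidablePred fun j => ColexLT (x j) (coords w) d] :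
    ((Finset.range n).filter fun j => ColexLT (x j) (coords w) d).card = rank V w := by
  classical
  have h1 : V.filter (fun u => ColexLT (coords u) (coords w) d) =
      (Finset.univ.filter fun i : Fin n => ColexLT (x i) (coords w) d).map ⟨v, hv⟩ := by
    ext u
    simp only [Finset.mem_filter, Finset.mem_map, Finset.mem_univ, true_and, hV,
      Function.Embedding.coeFn_mk]
    constructor
    · rintro ⟨⟨i, rfl⟩, h⟩
      exact ⟨i, by rwa [hx], rfl⟩
    · rintro ⟨i, h, rfl⟩
      exact ⟨⟨i, rfl⟩, by rwa [hx] at h⟩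
  have h2 : (Finset.range n).filter (fun j => ColexLT (x j) (coords w) d) =
      (Finset.univ.filter fun i : Fin n => ColexLT (x i) (coords w) d).map Fin.valEmbedding := by
    ext j
    simp only [Finset.mem_filter, Finset.mem_range, Finset.mem_map, Finset.mem_univ, true_and,
      Fin.valEmbedding_apply]
    constructor
    · rintro ⟨hj, h⟩
      exact ⟨⟨j, hj⟩, h, rfl⟩
    · rintro ⟨i, h, rfl⟩
      exact ⟨i.2, h⟩
  rw [rank, h1, h2, Finset.card_map, Finset.card_map]

/-- Up to the arrays ignored by `Agree`, the state now depends on the set `V` alone. The sorting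
permutation survives in the array `1` for translating the answer back to input positions. -/
theorem run_prepProg {n k : ℕ} {v : Fin n → Pt d} (hv : Function.Injective v)
    {V : Finset (Pt d)} (hV : ∀ w, w ∈ V ↔ ∃ i, v i = w) :
    Agree (prepProg.run (initState k v)) (canonState k V) ∧
      ∀ j < n, ∃ i : Fin n, (prepProg.run (initState k v)).iarr 1 j = i ∧ v i = enum V j := by
  classical
  have hcard : V.card = n := by
    have : V = Finset.univ.map ⟨v, hv⟩ := by
      ext w
      simp [hV]
    rw [this, Finset.card_map, Finset.card_univ, Fintype.card_fin]
  set s := initState k v with hs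
  have s0 : s.ireg 0 = n := rfl
  have s1 : s.ireg 1 = d := rfl
  have hrow : ∀ i : Fin n, s.rarr 0 i = coords (v i) := fun i => by
    ext c
    simp [hs, initState, coords]
  let R : ℕ → ℕ := fun i => if h : i < n then rank V (v ⟨i, h⟩) else 0
  have hRv : ∀ i : Fin n, R i = rank V (v i) := fun i => by simp [R]
  have hsort := run_sortProg (s := s) (R := R)
    (fun t h0 h1 hM h3 => by
      rw [run_rankProg, h0, h1, hM, s0, s1]
      rw [s0] at h3
      have h4 := hRv ⟨t.ireg 3, h3⟩
      have h5 := hrow ⟨t.ireg 3, h3⟩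
      simp only at h4 h5
      simp only [h4, h5]
      exact rank_eq_card_filter hv hV _ hrow)
    (fun i hi j hj hij => by
      have h1 := hRv ⟨i, hi⟩
      have h2 := hRv ⟨j, hj⟩
      simp only at h1 h2
      rw [h1, h2] at hij
      exact congrArg Fin.val (hv (rank_injOn V ((hV _).2 ⟨_, rfl⟩) ((hV _).2 ⟨_, rfl⟩) hij)))
  have fs := run_frame sortProg s
  have hcopy := run_copyProg (sortProg.run s)
  have fc := run_frame copyProg (sortProg.run s)
  set t1 := sortProg.run s
  set t2 := copyProg.run t1 with ht2
  have hperm : ∀ j < n, ∃ i : Fin n, t1.iarr 1 j = i ∧ v i = enum V j := by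
    intro j hj
    obtain ⟨w, hw, rfl⟩ := exists_rank_eq (V := V) (hcard ▸ hj)
    obtain ⟨i, rfl⟩ := (hV w).1 hw
    refine ⟨i, ?_, (enum_rank hw).symm⟩
    rw [← hRv]
    exact hsort i i.2
  have hrun : prepProg.run s = ((((t2.setI 3 0).setI 4 0).setI 5 0).setI 6 0).setI 7 0 := rfl
  have hrun' : t2 = (ForProg.seq sortProg copyProg).run s := rfl
  have f2 := run_frame (.seq sortProg copyProg) s
  rw [← hrun'] at f2
  rw [hrun]
  refine ⟨⟨?_, ?_, ?_, ?_⟩, ?_⟩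
  · ext y
    simp only [setI_ireg]
    by_cases hy : y ∈ Finset.Icc 3 7
    · rw [Finset.mem_Icc] at hy
      have h1 : (canonState k V).ireg y = 0 := by
        simp only [canonState]
        rw [if_neg (by omega), if_neg (by omega), if_neg (by omega)]
      rw [h1]
      split_ifs <;> first | rfl | omega
    · rw [Finset.mem_Icc] at hy
      rw [if_neg (by omega), if_neg (by omega), if_neg (by omega), if_neg (by omega),
        if_neg (by omega), f2.ireg y]
      · simp [hs, initState, canonState, hcard]
      · simp only [wI, sortProg, copyProg, rankProg, lessProg, Bool.or_eq_false_iff,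
          beq_eq_false_iff_ne, ne_eq, and_true]
        omega
  · ext y
    exact f2.rreg y rfl
  · intro a ha
    refine (f2.iarr a ?_).trans rfl
    simp [wA, sortProg, copyProg, rankProg, lessProg, Ne.symm ha]
  · intro a ha
    by_cases h2 : a = 2
    · subst h2
      ext i c
      simp only [setI_rarr]
      rw [hcopy]
      have h0 : t1.ireg 0 = n := fs.ireg 0 rfl
      have h1 : t1.ireg 1 = d := fs.ireg 1 rfl
      have hM : t1.rarr 0 = s.rarr 0 := fs.rarr 0 rfl
      have hM2 : t1.rarr 2 = s.rarr 2 := fs.rarr 2 rfl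
      rw [h0, h1, hM, hM2]
      by_cases hi : i < n
      · obtain ⟨l, hl, hlv⟩ := hperm i hi
        rw [hl, hrow, hlv]
        by_cases hc : c < d
        · simp [hi, hc, canonState]
        · simp [hc, canonState, coords, hs, initState]
      · rw [if_neg (fun h => hi h.1)]
        simp [canonState, enum_of_card_le (hcard.le.trans (not_lt.1 hi)), coords_zero, hs,
          initState]
    · refine (f2.rarr a ?_).trans ?_
      · simp [wM, sortProg, copyProg, rankProg, lessProg, Ne.symm h2]
      · ext i c
        simp [hs, initState, canonState, ha, h2]
  · have h1 : t2.iarr 1 = t1.iarr 1 := fc.iarr 1 rfl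
    simp only [setI_iarr, h1]
    exact hperm

/-! ### The core-set -/

/-- Translate the list back to positions in the input. -/
def outProg : ForProg :=
  .rep 3 2 (.cond (.ilt (.reg 3) (.reg 15)) (.iput 0 (.reg 3) (.get 1 (.get 2 (.reg 3)))) .skip)

theorem run_outProg {s : State} (h : s.ireg 15 ≤ s.ireg 2) :
    ∀ j < s.ireg 15, (outProg.run s).iarr 0 j = s.iarr 1 (s.iarr 2 j) := by
  have key := run_rep_induction (x := 3) (b := 2) (s := s)
    (p := .cond (.ilt (.reg 3) (.reg 15)) (.iput 0 (.reg 3) (.get 1 (.get 2 (.reg 3)))) .skip) rfl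
    (fun m t => ∀ j < m, j < s.ireg 15 → t.iarr 0 j = s.iarr 1 (s.iarr 2 j)) ?_ ?_
  · exact fun j hj => key j (hj.trans_le h) hj
  · simp
  · intro m t hm hx hf hI j hj hjr
    have h15 : t.ireg 15 = s.ireg 15 := hf.ireg 15 rfl
    have h1 : t.iarr 1 = s.iarr 1 := hf.iarr 1 rfl
    have h2 : t.iarr 2 = s.iarr 2 := hf.iarr 2 rfl
    simp only [run, BExp.holds, IExp.eval, hx, h15, h1, h2]
    by_cases hmr : m < s.ireg 15
    · rw [if_pos hmr]
      simp only [setI_iarr, putI_iarr, if_true, Function.update_apply]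
      split_ifs with hjm
      · rw [hjm]
      · exact hI j (by omega) hjr
    · rw [if_neg hmr]
      exact hI j (by omega) hjr

/-- The core-set of `V`. -/
noncomputable def coreset (d k : ℕ) (V : Finset (Pt d)) : Finset (Pt d) :=
  let t := selectProg.run (canonState k V)
  (Finset.range (t.ireg 15)).image (enum V ∘ t.iarr 2)

theorem isLocalOpt_coreset {k : ℕ} (hk : 1 ≤ k) (V : Finset (Pt d)) :
    IsLocalOpt k (V : Set (Pt d)) (coreset d k V : Set (Pt d)) := by
  have h := (run_selectProg (hasInput_canonState k V) rfl hk).2.2.2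
  rw [image_enum] at h
  have h1 : (coreset d k V : Set (Pt d)) =
      (enum V ∘ (selectProg.run (canonState k V)).iarr 2) ''
        Set.Iio ((selectProg.run (canonState k V)).ireg 15) := by
    simp [coreset]
  rwa [h1]

/-- The algorithm up to the length of the output. -/
def coresetProg : ForProg := .seq prepProg (.seq selectProg outProg)

/-- The last assignment overwrites register `0`, which well-formed bounded programs may not do, so
it is appended outside `toProg`; its two steps are the summand 2. As `k ≤ d`, all loop bounds are at
most `n + d`. -/
theorem computesInTime_coreset {k : ℕ} (hk : 1 ≤ k) (hkd : k ≤ d) :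
    ComputesInTime (.seq coresetProg.toProg (.iset 0 (.reg 15))) k (coreset d k)
      (fun n => (coresetProg.time + 2).eval (n + d)) := by
  classical
  intro n v hv
  generalize hVdef : Finset.univ.image v = V
  have hV : ∀ w, w ∈ V ↔ ∃ i, v i = w := fun w => by simp [← hVdef]
  have hcard : V.card = n := by
    rw [← hVdef, Finset.card_image_of_injective _ hv, Finset.card_univ, Fintype.card_fin]
  set s := initState k v with hs
  obtain ⟨t, ht, hle⟩ := exec_run (p := coresetProg) (by decide) (M := n + d) (s := s) (by
    intro y hy
    interval_cases y
    · exact Nat.le_add_right n d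
    · exact Nat.le_add_left d n
    · exact hkd.trans (Nat.le_add_left d n))
  refine ⟨_, _, Exec.seq ht (Exec.iset _ 0 (.reg 15)), ?_, ?_⟩
  · simpa [IExp.size] using hle
  · obtain ⟨hag, hperm⟩ := run_prepProg (k := k) hv hV
    set u := prepProg.run s
    have hag' := hag.run (p := selectProg) (by decide)
    have fsel := run_frame selectProg u
    obtain ⟨c1, c2, c3, -⟩ := run_selectProg (hasInput_canonState k V) rfl hk
    have hcs : coreset d k V = (Finset.range ((selectProg.run u).ireg 15)).image
        (enum V ∘ (selectProg.run u).iarr 2) := by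
      rw [hag'.ireg, hag'.iarr 2 (by norm_num)]
      rfl
    rw [← hag'.ireg, ← hag'.iarr 2 (by norm_num)] at c1 c2
    rw [← hag'.ireg] at c3
    set w := selectProg.run u
    have hw2 : w.ireg 2 = k := by
      rw [fsel.ireg 2 rfl, hag.ireg]
      rfl
    have hout := run_outProg (s := w) (by rw [hw2]; exact c3)
    have fo := run_frame outProg w
    have hrun : coresetProg.run s = outProg.run w := rfl
    have hw1 : w.iarr 1 = u.iarr 1 := fsel.iarr 1 rfl
    have h15 : (outProg.run w).ireg 15 = w.ireg 15 := fo.ireg 15 rfl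
    rw [hrun]
    -- Positive determinant means independent, hence distinct vectors, so the list length is the
    -- cardinality of the core-set.
    have hinj : Set.InjOn (enum V ∘ w.iarr 2) (Finset.range (w.ireg 15)) := by
      intro i hi j hj hij
      simp only [Finset.coe_range, Set.mem_Iio] at hi hj
      have h1 := (gdet_ne_zero_iff.1 c2.ne').injective
      have h2 := @h1 ⟨i, hi⟩ ⟨j, hj⟩ hij
      exact congrArg Fin.val h2
    have hlen : ((outProg.run w).setI 0 ((IExp.reg 15).eval (outProg.run w))).ireg 0 =
        w.ireg 15 := by
      simp [IExp.eval, h15]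
    refine ⟨?_, fun x => ?_⟩
    · rw [hlen, hcs, Finset.card_image_of_injOn hinj, Finset.card_range]
    · rw [hlen, hcs, Finset.mem_image]
      simp only [setI_iarr, Finset.mem_range]
      refine exists_congr fun j => and_congr_right fun hj => ?_
      obtain ⟨i, hi, hiv⟩ := hperm (w.iarr 2 j) (hcard ▸ c1 j hj)
      rw [hout j hj, hw1, hi]
      constructor
      · rintro rfl
        exact ⟨i, rfl, hiv⟩
      · rintro ⟨i', hi', rfl⟩
        rw [← Fin.ext hi', hiv]
        rfl

end RealRAM

/-! ### Assembly of the theorem -/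

theorem mainTheorem3 :
    ∃ (C : ℝ) (p : RealRAM.Prog) (P : Polynomial ℕ)
      (c : (d k : ℕ) → Finset (Pt d) → Finset (Pt d)),
      0 < C ∧
      ∀ d k : ℕ, 1 ≤ k → k ≤ d →
        IsComposableCoreset (detMax k)
            ((C * (k : ℝ) ^ 2 * Real.log ((k : ℝ) + 1) ^ 3) ^ k) (c d k) ∧
        (∀ V : Finset (Pt d),
            ((c d k V).card : ℝ) ≤ C * (k : ℝ) * Real.log ((k : ℝ) + 1) ^ 2) ∧
        RealRAM.ComputesInTime p k (c d k) (fun n => P.eval (n + d)) := by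
  -- The program and the polynomial are read off from `computesInTime_coreset`; neither depends on
  -- `d` or `k`.
  refine ⟨128, _, _, RealRAM.coreset, by norm_num, fun d k hk hkd => ⟨?_, fun V => ?_,
    RealRAM.computesInTime_coreset hk hkd⟩⟩
  · refine isComposableCoreset_of_isLocalOpt (RealRAM.isLocalOpt_coreset hk) (approx_bound hk) ?_
    have := half_le_log hk
    positivity
  · refine le_trans ?_ (size_bound hk)
    exact_mod_cast (RealRAM.isLocalOpt_coreset hk V).card_le
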